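/- Work over $\mathbb{C}$. Let $\mathbb{A}^2_*=\mathrm{Spec}(\mathbb{C}[x,y])\setminus\{(0,0)\}$, let $\sigma:\mathbb{G}_m\times\mathbb{A}^2_*\to\mathbb{A}^2_*$ be the action $\lambda\cdot(x,y)=(\lambda x,\lambda y)$, and let $\pi:\mathbb{A}^2_*\to\mathbb{P}^1=\mathrm{Proj}(\mathbb{C}[x,y])=\mathbb{A}^2_*/\mathbb{G}_m$ be the quotient morphism. For $d\in\mathbb{Z}$, the inclusion $\mathcal{O}_{\mathbb{P}^1}(-d)\subset\pi_*\mathcal{O}_{\mathbb{A}^2_*}=\bigoplus_{n\in\mathbb{Z}}\mathcal{O}_{\mathbb{P}^1}(n)$ as the functions that are homogeneous of degree $-d$ identifies $H^1(\mathbb{P}^1,\mathcal{O}_{\mathbb{P}^1}(-d))$ with a subgroup of $H^1(\mathbb{P}^1,\pi_*\mathcal{O}_{\mathbb{A}^2_*})\simeq H^1(\mathbb{A}^2_*,\mathcal{O}_{\mathbb{A}^2_*})$. A $\mathbb{G}_a$-bundle over $\mathbb{A}^2_*$ is a Zariski locally trivial principal $\mathbb{G}_a$-bundle; its isomorphy class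 is the class in $H^1(\mathbb{A}^2_*,\mathcal{O}_{\mathbb{A}^2_*})$ of the Čech cocycle $(h_{ij})$ such that the fibre coordinates of local $\mathbb{G}_a$-equivariant trivializations satisfy $t_i=t_j+h_{ij}$. **Proposition.** Let $d\in\mathbb{Z}$ and let $\rho:X\to\mathbb{A}^2_*$ be a $\mathbb{G}_a$-bundle. The following are equivalent: (a) the isomorphy class of $\rho:X\to\mathbb{A}^2_*$ belongs to $H^1(\mathbb{P}^1,\mathcal{O}_{\mathbb{P}^1}(-d))\subset H^1(\mathbb{A}^2_*,\mathcal{O}_{\mathbb{A}^2_*})$; (b) $\rho:X\to\mathbb{A}^2_*$ is isomorphic, as a $\mathbb{G}_a$-bundle over $\mathbb{A}^2_*$, to a $\mathbb{G}_a$-bundle $\tilde\rho:\tilde X\to\mathbb{A}^2_*$ admitting a lift $\tilde\sigma:\mathbb{G}_m\times\tilde X\to\tilde X$ of $\sigma$ (a $\mathbb{G}_m$-action for which $\tilde\rho$ is equivariant) for which there exist a covering of $\mathbb{A}^2_*$ by $\mathbb{G}_m$-stable affine open subsets $(U_i)_{i\in I}$ and $\mathbb{G}_a$-equivariant local trivializations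 $\tau_i:\tilde X|_{U_i}\xrightarrow{\sim}U_i\times\mathbb{G}_a$ such that every $\tau_i$ is $\mathbb{G}_m$-equivariant for $\tilde\sigma$ and the action of $\mathbb{G}_m$ on $U_i\times\mathbb{G}_a$ defined by $\lambda\cdot(u,t)=(\sigma(\lambda,u),\lambda^{-d}t)$. -/

import Mathlib

open CategoryTheory AlgebraicGeometry TopologicalSpace Opposite

noncomputable section

/-! ### Čech cohomology in degree one

`CechH1 F` is the colimit of the Čech groups `H¹(𝒰, F)` over all open coverings. Every covering is
refined by one of the form `(U x)` indexed by the points of the space, with `x ∈ U x`; these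
coverings form a directed set under pointwise inclusion, and it is enough to use them. -/

/-- An open covering indexed by the points of the space: a choice of an open neighbourhood of
every point. -/
structure PointedCover (X : TopCat.{0}) where
  nhd : X → Opens X
  mem_nhd : ∀ x, x ∈ nhd x

namespace PointedCover

/-- Finer coverings are larger. -/
instance (X : TopCat.{0}) : Preorder (PointedCover X) where
  le U V := ∀ x, V.nhd x ≤ U.nhd x
  le_refl U x := le_refl _
  le_trans U V W h k x := (k x).trans (h x)

instance (X : TopCat.{0}) : IsDirectedOrder (PointedCover X) where
  directed U V :=
    ⟨⟨fun x => U.nhd x ⊓ V.nhd x, fun x => ⟨U.mem_nhd x, V.mem_nhd x⟩⟩,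
      fun _ => inf_le_left, fun _ => inf_le_right⟩

instance (X : TopCat.{0}) : Nonempty (PointedCover X) := ⟨⟨fun _ => ⊤, fun _ => trivial⟩⟩

/-- The inverse image of a covering under a continuous map. -/
def comap {X Y : TopCat.{0}} (f : X ⟶ Y) (V : PointedCover Y) : PointedCover X where
  nhd x := (Opens.map f).obj (V.nhd (f x))
  mem_nhd x := V.mem_nhd (f x)

end PointedCover

section Cech

variable {X Y : TopCat.{0}}

/-- Restriction of sections of a presheaf of abelian groups. -/
def resHom (F : TopCat.Presheaf AddCommGrpCat.{0} X) {U V : Opens X} (h : V ≤ U) :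
    F.obj (op U) →+ F.obj (op V) :=
  (F.map (homOfLE h).op).hom

lemma resHom_resHom (F : TopCat.Presheaf AddCommGrpCat.{0} X) {U V W : Opens X} (h : V ≤ U)
    (k : W ≤ V) (s : F.obj (op U)) : resHom F k (resHom F h s) = resHom F (k.trans h) s := by
  have : F.map (homOfLE (k.trans h)).op = F.map (homOfLE h).op ≫ F.map (homOfLE k).op := by
    rw [← F.map_comp]; rfl
  simp [resHom, this]

/-- Čech `1`-cochains `(g x y)`, with `g x y` a section over `U x ∩ U y`. -/
abbrev CechC1 (F : TopCat.Presheaf AddCommGrpCat.{0} X) (U : PointedCover X) : Type :=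
  ∀ x y : X, F.obj (op (U.nhd x ⊓ U.nhd y))

/-- Čech `1`-cocycles: `g x y + g y z = g x z` over `U x ∩ U y ∩ U z`. -/
def cechZ1 (F : TopCat.Presheaf AddCommGrpCat.{0} X) (U : PointedCover X) :
    AddSubgroup (CechC1 F U) where
  carrier := {g | ∀ x y z,
    resHom F (V := U.nhd x ⊓ U.nhd y ⊓ U.nhd z) inf_le_left (g x y) +
      resHom F (le_inf (inf_le_left.trans inf_le_right) inf_le_right) (g y z) =
      resHom F (le_inf (inf_le_left.trans inf_le_left) inf_le_right) (g x z)}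
  zero_mem' x y z := by simp
  add_mem' {g h} hg hh x y z := by
    simp only [Pi.add_apply, map_add]
    rw [← hg, ← hh]; abel
  neg_mem' {g} hg x y z := by
    simp only [Pi.neg_apply, map_neg]
    rw [← hg]; abel

/-- The Čech differential `(δ s) x y = s y - s x` on `0`-cochains. -/
def cechDelta (F : TopCat.Presheaf AddCommGrpCat.{0} X) (U : PointedCover X) :
    (∀ x : X, F.obj (op (U.nhd x))) →+ CechC1 F U where
  toFun s x y := resHom F inf_le_right (s y) - resHom F inf_le_left (s x)
  map_zero' := by ext; simp
  map_add' s t := by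
    funext x y
    simp only [Pi.add_apply, map_add]; abel

/-- `Ȟ¹(𝒰, F)`: Čech cocycles modulo Čech coboundaries. -/
abbrev CechH1Cover (F : TopCat.Presheaf AddCommGrpCat.{0} X) (U : PointedCover X) : Type :=
  cechZ1 F U ⧸ (cechDelta F U).range.addSubgroupOf (cechZ1 F U)

/-- The maps `G(A) → F(f⁻¹ A) → F(U)` given by a morphism `φ : G ⟶ f_* F`, for `U ⊆ f⁻¹ A`. -/
def pullHom (f : X ⟶ Y) {F : TopCat.Presheaf AddCommGrpCat.{0} X}
    {G : TopCat.Presheaf AddCommGrpCat.{0} Y} (φ : G ⟶ (TopCat.Presheaf.pushforward _ f).obj F)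
    {A : Opens Y} {U : Opens X} (h : U ≤ (Opens.map f).obj A) :
    G.obj (op A) →+ F.obj (op U) :=
  (resHom F h).comp (φ.app (op A)).hom

section pull

variable (f : X ⟶ Y) {F : TopCat.Presheaf AddCommGrpCat.{0} X}
    {G : TopCat.Presheaf AddCommGrpCat.{0} Y} (φ : G ⟶ (TopCat.Presheaf.pushforward _ f).obj F)

lemma le_map_inf {A B : Opens Y} {U V : Opens X} (h : U ≤ (Opens.map f).obj A)
    (k : V ≤ (Opens.map f).obj B) : U ⊓ V ≤ (Opens.map f).obj (A ⊓ B) :=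
  fun _ hx => ⟨h hx.1, k hx.2⟩

lemma le_map_of_le {A B : Opens Y} {U : Opens X} (h : U ≤ (Opens.map f).obj B)
    (k : B ≤ A) : U ≤ (Opens.map f).obj A :=
  fun _ hx => k (h hx)

lemma resHom_pullHom {A : Opens Y} {U V : Opens X} (h : U ≤ (Opens.map f).obj A) (k : V ≤ U)
    (s : G.obj (op A)) : resHom F k (pullHom f φ h s) = pullHom f φ (k.trans h) s :=
  resHom_resHom F h k _

lemma pullHom_resHom {A B : Opens Y} {U : Opens X} (h : U ≤ (Opens.map f).obj B) (k : B ≤ A)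
    (s : G.obj (op A)) : pullHom f φ h (resHom G k s) = pullHom f φ (le_map_of_le f h k) s := by
  have e : (φ.app (op B)).hom (resHom G k s) =
      resHom F ((Opens.map f).map (homOfLE k)).le ((φ.app (op A)).hom s) :=
    congrArg (fun m => m.hom s) (φ.naturality (homOfLE k).op)
  exact (congrArg (resHom F h) e).trans (resHom_resHom F _ _ _)

variable {V : PointedCover Y} {U : PointedCover X}

/-- For a covering `U` of `X` finer than the inverse image of a covering `V` of `Y`, the induced
map on `1`-cocycles. -/
def cechZ1Map (h : ∀ x, U.nhd x ≤ (Opens.map f).obj (V.nhd (f x))) :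
    cechZ1 G V →+ cechZ1 F U where
  toFun g := ⟨fun x y => pullHom f φ (le_map_inf f (h x) (h y)) (g.1 (f x) (f y)), by
    intro x y z
    have key := congrArg (pullHom f φ (le_map_inf f (le_map_inf f (h x) (h y)) (h z)))
      (g.2 (f x) (f y) (f z))
    simp only [map_add, pullHom_resHom] at key
    simp only [resHom_pullHom]
    exact key⟩
  map_zero' := by
    apply Subtype.ext
    funext x y
    exact map_zero (pullHom f φ _)
  map_add' a b := by
    apply Subtype.ext
    funext x y
    exact map_add (pullHom f φ _) _ _

lemma cechZ1Map_range (h : ∀ x, U.nhd x ≤ (Opens.map f).obj (V.nhd (f x))) :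
    (cechDelta G V).range.addSubgroupOf (cechZ1 G V) ≤
      ((cechDelta F U).range.addSubgroupOf (cechZ1 F U)).comap (cechZ1Map f φ h) := by
  rintro ⟨g, hg⟩ ⟨s, hs⟩
  refine ⟨fun x => pullHom f φ (h x) (s (f x)), ?_⟩
  have hs' : cechDelta G V s = g := hs
  subst hs'
  funext x y
  change resHom F inf_le_right (pullHom f φ (h y) (s (f y))) -
      resHom F inf_le_left (pullHom f φ (h x) (s (f x))) =
    pullHom f φ (le_map_inf f (h x) (h y))
      (resHom G inf_le_right (s (f y)) - resHom G inf_le_left (s (f x)))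
  rw [map_sub, resHom_pullHom, resHom_pullHom, pullHom_resHom, pullHom_resHom]

/-- The induced map `Ȟ¹(𝒱, G) → Ȟ¹(𝒰, F)`. -/
def cechH1CoverMap (h : ∀ x, U.nhd x ≤ (Opens.map f).obj (V.nhd (f x))) :
    CechH1Cover G V →+ CechH1Cover F U :=
  QuotientAddGroup.map _ _ (cechZ1Map f φ h) (cechZ1Map_range f φ h)

end pull

/-- The refinement maps `Ȟ¹(𝒰, F) → Ȟ¹(𝒱, F)`, induced by restriction of sections. -/
def cechH1Refine (F : TopCat.Presheaf AddCommGrpCat.{0} X) (U V : PointedCover X) (h : U ≤ V) :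
    CechH1Cover F U →+ CechH1Cover F V :=
  cechH1CoverMap (𝟙 X) (F := F) (G := F) (V := U) (U := V) { app := fun _ => 𝟙 _ } h

open Classical in
/-- `Ȟ¹(X, F)`: the colimit of the groups `Ȟ¹(𝒰, F)` over the open coverings of `X`. -/
abbrev CechH1 (F : TopCat.Presheaf AddCommGrpCat.{0} X) : Type :=
  AddCommGroup.DirectLimit (CechH1Cover F) (cechH1Refine F)

open Classical in
/-- The class in `Ȟ¹(X, F)` of a cocycle on an open covering. -/
def cechClass (F : TopCat.Presheaf AddCommGrpCat.{0} X) (U : PointedCover X) (g : cechZ1 F U) :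
    CechH1 F :=
  AddCommGroup.DirectLimit.of (CechH1Cover F) (cechH1Refine F) U (QuotientAddGroup.mk g)

lemma cechH1Refine_coverMap (f : X ⟶ Y) {F : TopCat.Presheaf AddCommGrpCat.{0} X}
    {G : TopCat.Presheaf AddCommGrpCat.{0} Y} (φ : G ⟶ (TopCat.Presheaf.pushforward _ f).obj F)
    (V W : PointedCover Y) (h : V ≤ W) (h' : V.comap f ≤ W.comap f) (c : CechH1Cover G V) :
    cechH1CoverMap f φ (U := W.comap f) (fun _ => le_refl _) (cechH1Refine G V W h c) =
      cechH1Refine F (V.comap f) (W.comap f) h'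
        (cechH1CoverMap f φ (U := V.comap f) (fun _ => le_refl _) c) := by
  obtain ⟨g, rfl⟩ := QuotientAddGroup.mk_surjective c
  apply congrArg QuotientAddGroup.mk
  apply Subtype.ext
  funext x y
  exact (pullHom_resHom f φ (le_map_inf f (le_refl _) (le_refl _))
    (le_inf (inf_le_left.trans (h (f x))) (inf_le_right.trans (h (f y)))) (g.1 (f x) (f y))).trans
    (resHom_pullHom f φ _ _ _).symm

open Classical in
/-- The homomorphism `Ȟ¹(Y, G) → Ȟ¹(X, F)` induced by a continuous map `f : X ⟶ Y` and a morphism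
`G ⟶ f_* F`, namely `Ȟ¹(Y, G) → Ȟ¹(Y, f_* F) → Ȟ¹(X, F)`. -/
def cechH1Map (f : X ⟶ Y) {F : TopCat.Presheaf AddCommGrpCat.{0} X}
    {G : TopCat.Presheaf AddCommGrpCat.{0} Y} (φ : G ⟶ (TopCat.Presheaf.pushforward _ f).obj F) :
    CechH1 G →+ CechH1 F :=
  AddCommGroup.DirectLimit.lift (CechH1Cover G) (cechH1Refine G) _
    (fun V => (AddCommGroup.DirectLimit.of (CechH1Cover F) (cechH1Refine F) (V.comap f)).comp
      (cechH1CoverMap f φ (U := V.comap f) (fun _ => le_refl _)))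
    (fun V W h c => by
      simp only [AddMonoidHom.comp_apply]
      have h' : V.comap f ≤ W.comap f := fun x => ((Opens.map f).map (homOfLE (h (f x)))).le
      rw [cechH1Refine_coverMap f φ V W h h']
      exact AddCommGroup.DirectLimit.of_f h' _)

end Cech

/-! ### Actions of `𝔾ₐ` and `𝔾ₘ`, and `𝔾ₐ`-bundles

Actions are described on `T`-valued points: by the Yoneda lemma, an action of `𝔾ₐ` (resp. `𝔾ₘ`) on
a scheme `X` is the same as an action of `Γ(T, 𝒪_T)` (resp. of `Γ(T, 𝒪_T)ˣ`) on `X(T)`, natural in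
the scheme `T`. If `X` is a complex scheme and the action preserves the structure morphism
`X → Spec ℂ`, this is an action of the complex group scheme `𝔾ₐ` (resp. `𝔾ₘ`). -/

/-- An action of the additive group `𝔾ₐ` on a scheme. -/
structure GaAction (X : Scheme.{0}) where
  act : ∀ {T : Scheme.{0}}, Γ(T, ⊤) → (T ⟶ X) → (T ⟶ X)
  zero_act : ∀ {T : Scheme.{0}} (p : T ⟶ X), act 0 p = p
  add_act : ∀ {T : Scheme.{0}} (a b : Γ(T, ⊤)) (p : T ⟶ X), act (a + b) p = act a (act b p)
  comp_act : ∀ {T T' : Scheme.{0}} (f : T' ⟶ T) (a : Γ(T, ⊤)) (p : T ⟶ X),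
    f ≫ act a p = act (f.appTop a) (f ≫ p)

/-- An action of the multiplicative group `𝔾ₘ` on a scheme. -/
structure GmAction (X : Scheme.{0}) where
  act : ∀ {T : Scheme.{0}}, (Γ(T, ⊤))ˣ → (T ⟶ X) → (T ⟶ X)
  one_act : ∀ {T : Scheme.{0}} (p : T ⟶ X), act 1 p = p
  mul_act : ∀ {T : Scheme.{0}} (a b : (Γ(T, ⊤))ˣ) (p : T ⟶ X), act (a * b) p = act a (act b p)
  comp_act : ∀ {T T' : Scheme.{0}} (f : T' ⟶ T) (a : (Γ(T, ⊤))ˣ) (p : T ⟶ X),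
    f ≫ act a p = act (Units.map f.appTop.hom a) (f ≫ p)

/-- A morphism `f : X ⟶ Y` is `𝔾ₐ`-equivariant. -/
def GaAction.Equivariant {X Y : Scheme.{0}} (α : GaAction X) (β : GaAction Y) (f : X ⟶ Y) : Prop :=
  ∀ {T : Scheme.{0}} (a : Γ(T, ⊤)) (p : T ⟶ X), α.act a p ≫ f = β.act a (p ≫ f)

/-- A morphism `f : X ⟶ Y` is `𝔾ₘ`-equivariant. -/
def GmAction.Equivariant {X Y : Scheme.{0}} (α : GmAction X) (β : GmAction Y) (f : X ⟶ Y) : Prop :=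
  ∀ {T : Scheme.{0}} (a : (Γ(T, ⊤))ˣ) (p : T ⟶ X), α.act a p ≫ f = β.act a (p ≫ f)

/-- The scheme `U × 𝔾ₐ`. -/
abbrev timesGa (U : Scheme.{0}) : Scheme.{0} := 𝔸(PUnit; U)

namespace timesGa

/-- The projection `U × 𝔾ₐ ⟶ U`. -/
abbrev fst (U : Scheme.{0}) : timesGa U ⟶ U := 𝔸(PUnit; U) ↘ U

/-- The `𝔾ₐ`-coordinate `t` of a `T`-point of `U × 𝔾ₐ`. -/
def coord {U T : Scheme.{0}} (p : T ⟶ timesGa U) : Γ(T, ⊤) :=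
  p.appTop (AffineSpace.coord U PUnit.unit)

/-- The `T`-point `(u, t)` of `U × 𝔾ₐ`. -/
def mk {U T : Scheme.{0}} (u : T ⟶ U) (t : Γ(T, ⊤)) : T ⟶ timesGa U :=
  AffineSpace.homOfVector u (fun _ => t)

@[simp] lemma mk_fst {U T : Scheme.{0}} (u : T ⟶ U) (t : Γ(T, ⊤)) : mk u t ≫ fst U = u :=
  AffineSpace.homOfVector_over _ _

@[simp] lemma coord_mk {U T : Scheme.{0}} (u : T ⟶ U) (t : Γ(T, ⊤)) : coord (mk u t) = t :=
  AffineSpace.homOfVector_appTop_coord _ _ _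

lemma coord_comp {U T T' : Scheme.{0}} (f : T' ⟶ T) (p : T ⟶ timesGa U) :
    coord (f ≫ p) = f.appTop (coord p) := by
  rw [coord, coord, Scheme.Hom.comp_appTop]; rfl

lemma ext {U T : Scheme.{0}} {p q : T ⟶ timesGa U} (h₁ : p ≫ fst U = q ≫ fst U)
    (h₂ : coord p = coord q) : p = q :=
  AffineSpace.hom_ext h₁ (fun _ => h₂)

/-- `𝔾ₐ` acts on `U × 𝔾ₐ` by translations on the second factor. -/
def translation (U : Scheme.{0}) : GaAction (timesGa U) where
  act a p := mk (p ≫ fst U) (coord p + a)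
  zero_act p := ext (by simp) (by simp)
  add_act a b p := ext (by simp) (by simp; ring)
  comp_act f a p := ext (by simp) (by simp [coord_comp])

end timesGa

/-- A `𝔾ₐ`-equivariant trivialization of `ρ : X ⟶ S` over the open subset `U` of `S`: an isomorphism
over `U` between `U × 𝔾ₐ` and `ρ⁻¹(U)`. It is given as a morphism `U × 𝔾ₐ ⟶ X` which makes
`U × 𝔾ₐ` into the fibre product `ρ⁻¹(U) = X ×_S U`. -/
structure GaTrivialization {X S : Scheme.{0}} (ρ : X ⟶ S) (α : GaAction X) (U : S.Opens) where
  hom : timesGa U ⟶ X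
  isPullback : IsPullback hom (timesGa.fst U) ρ U.ι
  equivariant : (timesGa.translation U).Equivariant α hom

/-- A `𝔾ₐ`-bundle over `S`: a scheme over `S` with a `𝔾ₐ`-action along the fibres which is, locally
on `S` for the Zariski topology, equivariantly isomorphic to the trivial one. -/
structure GaBundle (S : Scheme.{0}) where
  X : Scheme.{0}
  ρ : X ⟶ S
  action : GaAction X
  act_ρ : ∀ {T : Scheme.{0}} (a : Γ(T, ⊤)) (p : T ⟶ X), action.act a p ≫ ρ = p ≫ ρ
  locallyTrivial : ∀ s : S, ∃ U : S.Opens, s ∈ U ∧ Nonempty (GaTrivialization ρ action U)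

/-- Isomorphisms of `𝔾ₐ`-bundles over `S`. -/
structure GaBundle.Iso {S : Scheme.{0}} (E E' : GaBundle S) where
  iso : E.X ≅ E'.X
  comp_ρ : iso.hom ≫ E'.ρ = E.ρ
  equivariant : E.action.Equivariant E'.action iso.hom

namespace GaTrivialization

variable {X S : Scheme.{0}} {ρ : X ⟶ S} {α : GaAction X} {U : S.Opens}

/-- The `T`-point of `U × 𝔾ₐ` corresponding to a `T`-point `p` of `X` lying over `u : T ⟶ U`. -/
def lift (τ : GaTrivialization ρ α U) {T : Scheme.{0}} (p : T ⟶ X) (u : T ⟶ U)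
    (h : p ≫ ρ = u ≫ U.ι) : T ⟶ timesGa U :=
  τ.isPullback.lift p u h

@[simp] lemma lift_hom (τ : GaTrivialization ρ α U) {T : Scheme.{0}} (p : T ⟶ X) (u : T ⟶ U)
    (h : p ≫ ρ = u ≫ U.ι) : τ.lift p u h ≫ τ.hom = p :=
  τ.isPullback.lift_fst _ _ _

@[simp] lemma lift_fst (τ : GaTrivialization ρ α U) {T : Scheme.{0}} (p : T ⟶ X) (u : T ⟶ U)
    (h : p ≫ ρ = u ≫ U.ι) : τ.lift p u h ≫ timesGa.fst U = u :=
  τ.isPullback.lift_snd _ _ _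

/-- The fibre coordinate `t(p)` of a `T`-point `p` of `X` lying over `u : T ⟶ U`. -/
def coord (τ : GaTrivialization ρ α U) {T : Scheme.{0}} (p : T ⟶ X) (u : T ⟶ U)
    (h : p ≫ ρ = u ≫ U.ι) : Γ(T, ⊤) :=
  timesGa.coord (τ.lift p u h)

/-- The local section `u ↦ (u, 0)` of `ρ` over `U`. -/
def zeroSection (τ : GaTrivialization ρ α U) : U.toScheme ⟶ X :=
  timesGa.mk (𝟙 _) 0 ≫ τ.hom

lemma zeroSection_ρ (τ : GaTrivialization ρ α U) : τ.zeroSection ≫ ρ = U.ι := by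
  rw [zeroSection, Category.assoc, τ.isPullback.w, ← Category.assoc, timesGa.mk_fst,
    Category.id_comp]

lemma coord_comp (τ : GaTrivialization ρ α U) {T T' : Scheme.{0}} (f : T' ⟶ T) (p : T ⟶ X)
    (u : T ⟶ U) (h : p ≫ ρ = u ≫ U.ι) (h' : (f ≫ p) ≫ ρ = (f ≫ u) ≫ U.ι) :
    τ.coord (f ≫ p) (f ≫ u) h' = f.appTop (τ.coord p u h) := by
  rw [coord, coord, ← timesGa.coord_comp]
  congr 1
  apply τ.isPullback.hom_ext
  · rw [Category.assoc]
    erw [lift_hom, lift_hom]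
  · rw [Category.assoc]
    erw [lift_fst, lift_fst]

lemma coord_act (τ : GaTrivialization ρ α U) {T : Scheme.{0}} (a : Γ(T, ⊤)) (p : T ⟶ X)
    (u : T ⟶ U) (h : p ≫ ρ = u ≫ U.ι) (h' : α.act a p ≫ ρ = u ≫ U.ι) :
    τ.coord (α.act a p) u h' = τ.coord p u h + a := by
  have : τ.lift (α.act a p) u h' = (timesGa.translation U).act a (τ.lift p u h) := by
    apply τ.isPullback.hom_ext
    · rw [τ.equivariant]
      erw [lift_hom, lift_hom]
    · erw [lift_fst]
      simp [timesGa.translation]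
  rw [coord, this]
  simp [timesGa.translation, coord]

lemma eq_act_zeroSection (τ : GaTrivialization ρ α U) {T : Scheme.{0}} (p : T ⟶ X)
    (u : T ⟶ U) (h : p ≫ ρ = u ≫ U.ι) :
    p = α.act (τ.coord p u h) (u ≫ τ.zeroSection) := by
  rw [zeroSection, ← Category.assoc, ← τ.equivariant]
  conv_lhs => rw [← τ.lift_hom p u h]
  congr 1
  apply timesGa.ext
  · simp [timesGa.translation]
  · simp [timesGa.translation, coord, timesGa.coord_comp]

end GaTrivialization

/-- The structure sheaf of a scheme, as a sheaf of abelian groups. -/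
def addStructureSheaf (S : Scheme.{0}) : TopCat.Presheaf AddCommGrpCat.{0} S.carrier :=
  S.presheaf ⋙ forget₂ CommRingCat RingCat ⋙ forget₂ RingCat AddCommGrpCat

namespace GaBundle

variable {S : Scheme.{0}} (E : GaBundle S)

/-- A covering over which the bundle is trivial. -/
def cover : PointedCover S.carrier where
  nhd s := (E.locallyTrivial s).choose
  mem_nhd s := (E.locallyTrivial s).choose_spec.1

/-- Trivializations over the members of `E.cover`. -/
def trivialization (s : S) : GaTrivialization E.ρ E.action (E.cover.nhd s) :=
  (E.locallyTrivial s).choose_spec.2.some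

variable {E} in
/-- The transition function `h` between trivializations `τ` over `U` and `τ'` over `V`: the function
on `U ∩ V` such that `t = t' + h` for the fibre coordinates `t` and `t'` of `τ` and `τ'` or, in other
words, the `τ`-coordinate of the section whose `τ'`-coordinate is `0`. -/
def transition {U V : S.Opens} (τ : GaTrivialization E.ρ E.action U)
    (τ' : GaTrivialization E.ρ E.action V) : Γ(S, U ⊓ V) :=
  (U ⊓ V).topIso.hom
    (τ.coord (S.homOfLE (inf_le_right : U ⊓ V ≤ V) ≫ τ'.zeroSection)
      (S.homOfLE (inf_le_left : U ⊓ V ≤ U)) (by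
        rw [Category.assoc, τ'.zeroSection_ρ, Scheme.homOfLE_ι, Scheme.homOfLE_ι]))

lemma map_topIso_hom {S : Scheme.{0}} {A B : S.Opens} (h : B ≤ A) (s : Γ(A, ⊤)) :
    S.presheaf.map (homOfLE h).op (A.topIso.hom s) = B.topIso.hom ((S.homOfLE h).appTop s) := by
  have : A.topIso.hom ≫ S.presheaf.map (homOfLE h).op =
      (S.homOfLE h).appTop ≫ B.topIso.hom := by
    rw [Scheme.Opens.topIso_hom, Scheme.Opens.topIso_hom, Scheme.homOfLE_appTop]
    erw [← S.presheaf.map_comp, ← S.presheaf.map_comp]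
    rfl
  exact congrArg (fun m => m.hom s) this

lemma transition_restrict {U V W : S.Opens} (τ : GaTrivialization E.ρ E.action U)
    (τ' : GaTrivialization E.ρ E.action V) (h : W ≤ U ⊓ V) (p : W.toScheme ⟶ E.X)
    (hp : p ≫ E.ρ = W.ι) :
    S.presheaf.map (homOfLE h).op (transition τ τ') =
      W.topIso.hom (τ.coord p (S.homOfLE (h.trans inf_le_left)) (by simp [hp]) -
        τ'.coord p (S.homOfLE (h.trans inf_le_right)) (by simp [hp])) := by
  rw [transition, map_topIso_hom]
  congr 1
  rw [eq_sub_iff_add_eq]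
  have hq : (S.homOfLE (h.trans inf_le_right) ≫ τ'.zeroSection) ≫ E.ρ =
      S.homOfLE (h.trans inf_le_left) ≫ U.ι := by
    rw [Category.assoc, τ'.zeroSection_ρ, Scheme.homOfLE_ι, Scheme.homOfLE_ι]
  have e1 := τ'.eq_act_zeroSection p (S.homOfLE (h.trans inf_le_right)) (by simp [hp])
  set a := τ'.coord p (S.homOfLE (h.trans inf_le_right)) (by simp [hp]) with ha
  have e2 := τ.coord_act a _ (S.homOfLE (h.trans inf_le_left)) hq (by rw [E.act_ρ]; exact hq)
  have e3 : τ.coord p (S.homOfLE (h.trans inf_le_left)) (by simp [hp]) =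
      τ.coord (E.action.act a (S.homOfLE (h.trans inf_le_right) ≫ τ'.zeroSection))
        (S.homOfLE (h.trans inf_le_left)) (by rw [E.act_ρ]; exact hq) := by
    congr 1
  rw [e3, e2]
  congr 1
  rw [← τ.coord_comp]
  · congr 1
    · simp [← Category.assoc]
    · simp
  · simp [τ'.zeroSection_ρ]

/-- The Čech cocycle of a bundle for a family of trivializations over a covering. -/
def cocycle (𝒰 : PointedCover S.carrier)
    (τ : ∀ s : S, GaTrivialization E.ρ E.action (𝒰.nhd s)) :
    cechZ1 (addStructureSheaf S) 𝒰 :=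
  ⟨fun x y => transition (τ x) (τ y), by
    intro x y z
    set W : S.Opens := 𝒰.nhd x ⊓ 𝒰.nhd y ⊓ 𝒰.nhd z
    have hz : (S.homOfLE (inf_le_right : W ≤ 𝒰.nhd z) ≫ (τ z).zeroSection) ≫ E.ρ = W.ι := by
      rw [Category.assoc, (τ z).zeroSection_ρ, Scheme.homOfLE_ι]
    have h1 := E.transition_restrict (τ x) (τ y) (W := W) inf_le_left _ hz
    have h2 := E.transition_restrict (τ y) (τ z) (W := W)
      (le_inf (inf_le_left.trans inf_le_right) inf_le_right) _ hz
    have h3 := E.transition_restrict (τ x) (τ z) (W := W)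
      (le_inf (inf_le_left.trans inf_le_left) inf_le_right) _ hz
    have add : ∀ a b c : Γ(W, ⊤),
        W.topIso.hom (a - b) + W.topIso.hom (b - c) = W.topIso.hom (a - c) := fun a b c => by
      rw [← map_add, sub_add_sub_cancel]
    exact ((congrArg₂ (fun a b : Γ(S, W) => a + b) h1 h2).trans (add _ _ _)).trans h3.symm⟩

/-- The class of a `𝔾ₐ`-bundle over `S` in `H¹(S, 𝒪_S)`. -/
def cohomologyClass : CechH1 (addStructureSheaf S) :=
  cechClass _ E.cover (E.cocycle E.cover E.trivialization)

end GaBundle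

/-! ### The punctured affine plane and the projective line -/

/-- The polynomial ring `ℂ[x, y]`, with `x = X 0` and `y = X 1`. -/
abbrev PolyRing : Type := MvPolynomial (Fin 2) ℂ

/-- The affine plane `𝔸² = Spec ℂ[x, y]`. -/
abbrev affinePlane : Scheme.{0} := Spec (.of PolyRing)

/-- The complement of the origin `{x = y = 0}` in the affine plane, as an open subset. -/
def puncturedOpen : affinePlane.Opens :=
  PrimeSpectrum.basicOpen (MvPolynomial.X 0 : PolyRing) ⊔
    PrimeSpectrum.basicOpen (MvPolynomial.X 1 : PolyRing)

/-- The punctured affine plane `𝔸²_*`. -/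
abbrev puncturedPlane : Scheme.{0} := puncturedOpen.toScheme

/-- The ring homomorphism `ℂ[x, y] → Γ(T, 𝒪_T)` given by a `T`-point of the affine plane. -/
def pointHom {T : Scheme.{0}} (p : T ⟶ affinePlane) : PolyRing →+* Γ(T, ⊤) :=
  ((Scheme.ΓSpecIso (.of PolyRing)).inv ≫ p.appTop).hom

/-- The `T`-point of the affine plane given by a ring homomorphism `ℂ[x, y] → Γ(T, 𝒪_T)`. -/
def pointOf {T : Scheme.{0}} (φ : PolyRing →+* Γ(T, ⊤)) : T ⟶ affinePlane :=
  T.toSpecΓ ≫ Spec.map (CommRingCat.ofHom φ)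

@[simp] lemma pointHom_pointOf {T : Scheme.{0}} (φ : PolyRing →+* Γ(T, ⊤)) :
    pointHom (pointOf φ) = φ := by
  have : (Scheme.ΓSpecIso (.of PolyRing)).inv ≫ (pointOf φ).appTop = CommRingCat.ofHom φ := by
    rw [pointOf, Scheme.Hom.comp_appTop, Scheme.toSpecΓ_appTop,
      ← Scheme.ΓSpecIso_inv_naturality_assoc, Iso.inv_hom_id, Category.comp_id]
  rw [pointHom, this]
  rfl

lemma pointHom_injective {T : Scheme.{0}} {p q : T ⟶ affinePlane}
    (h : pointHom p = pointHom q) : p = q := by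
  apply ext_of_isAffine
  have : (Scheme.ΓSpecIso (.of PolyRing)).inv ≫ p.appTop =
      (Scheme.ΓSpecIso (.of PolyRing)).inv ≫ q.appTop := CommRingCat.hom_ext h
  exact (cancel_epi _).mp this

lemma pointHom_comp {T T' : Scheme.{0}} (f : T' ⟶ T) (p : T ⟶ affinePlane) :
    pointHom (f ≫ p) = f.appTop.hom.comp (pointHom p) := by
  rw [pointHom, pointHom, Scheme.Hom.comp_appTop]
  rfl

lemma preimage_basicOpen {T : Scheme.{0}} (p : T ⟶ affinePlane) (f : PolyRing) :
    p ⁻¹ᵁ (PrimeSpectrum.basicOpen f : affinePlane.Opens) = T.basicOpen (pointHom p f) := by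
  have h := congrArg (fun V => p ⁻¹ᵁ V) (basicOpen_eq_of_affine (R := .of PolyRing) f)
  exact h.symm.trans (Scheme.preimage_basicOpen_top p _)

/-- The ring homomorphism `f(x, y) ↦ f(λ x, λ y)` attached to a unit `λ` of `Γ(T, 𝒪_T)` and a
`T`-point `(x, y)` of the affine plane. -/
def scaleHom {T : Scheme.{0}} (a : (Γ(T, ⊤))ˣ) (φ : PolyRing →+* Γ(T, ⊤)) :
    PolyRing →+* Γ(T, ⊤) :=
  MvPolynomial.eval₂Hom (φ.comp MvPolynomial.C) (fun i => (a : Γ(T, ⊤)) * φ (MvPolynomial.X i))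

lemma range_scale_subset {T : Scheme.{0}} (a : (Γ(T, ⊤))ˣ) (p : T ⟶ puncturedPlane) :
    Set.range (pointOf (scaleHom a (pointHom (p ≫ puncturedOpen.ι)))) ⊆
      Set.range puncturedOpen.ι := by
  rintro _ ⟨t, rfl⟩
  rw [Scheme.Opens.range_ι]
  have key : ∀ i : Fin 2, ∀ s : T,
      (p ≫ puncturedOpen.ι) s ∈ PrimeSpectrum.basicOpen (MvPolynomial.X i : PolyRing) →
      pointOf (scaleHom a (pointHom (p ≫ puncturedOpen.ι))) s ∈
        PrimeSpectrum.basicOpen (MvPolynomial.X i : PolyRing) := by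
    intro i s hs
    have h1 : s ∈ T.basicOpen (pointHom (p ≫ puncturedOpen.ι) (MvPolynomial.X i)) := by
      rw [← preimage_basicOpen]; exact hs
    have h2 : s ∈ T.basicOpen (pointHom (pointOf (scaleHom a (pointHom (p ≫ puncturedOpen.ι))))
        (MvPolynomial.X i)) := by
      rw [pointHom_pointOf, scaleHom, MvPolynomial.eval₂Hom_X', Scheme.basicOpen_mul,
        Scheme.basicOpen_of_isUnit _ a.isUnit]
      exact ⟨trivial, h1⟩
    rw [← preimage_basicOpen] at h2
    exact h2
  have hp : (p ≫ puncturedOpen.ι) t ∈ puncturedOpen := by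
    rw [Scheme.Hom.comp_apply]
    exact (p t).2
  rcases hp with h | h
  · exact Or.inl (key 0 t h)
  · exact Or.inr (key 1 t h)

/-- The action `σ` of `𝔾ₘ` on `𝔸²_*` given by `λ · (x, y) = (λ x, λ y)`. -/
def scalarAction : GmAction puncturedPlane where
  act a p := IsOpenImmersion.lift puncturedOpen.ι
    (pointOf (scaleHom a (pointHom (p ≫ puncturedOpen.ι)))) (range_scale_subset a p)
  one_act p := by
    rw [← cancel_mono puncturedOpen.ι, IsOpenImmersion.lift_fac]
    apply pointHom_injective
    rw [pointHom_pointOf]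
    apply MvPolynomial.ringHom_ext <;> intros <;> simp [scaleHom]
  mul_act a b p := by
    rw [← cancel_mono puncturedOpen.ι, IsOpenImmersion.lift_fac, IsOpenImmersion.lift_fac]
    apply pointHom_injective
    rw [IsOpenImmersion.lift_fac, pointHom_pointOf, pointHom_pointOf, pointHom_pointOf]
    apply MvPolynomial.ringHom_ext <;> intros <;> simp [scaleHom, mul_assoc]
  comp_act f a p := by
    rw [← cancel_mono puncturedOpen.ι, Category.assoc, IsOpenImmersion.lift_fac,
      IsOpenImmersion.lift_fac]
    apply pointHom_injective
    rw [pointHom_comp, pointHom_pointOf, pointHom_pointOf, Category.assoc,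
      pointHom_comp f (p ≫ puncturedOpen.ι)]
    generalize pointHom (p ≫ puncturedOpen.ι) = φ
    apply MvPolynomial.ringHom_ext <;> intros <;> simp [scaleHom]

/-- The open subset `U` is stable under the `𝔾ₘ`-action: `λ · u` lies in `U` for all
`T`-points `λ` of `𝔾ₘ` and `u` of `U`. -/
def GmAction.Stable {S : Scheme.{0}} (σ : GmAction S) (U : S.Opens) : Prop :=
  ∀ {T : Scheme.{0}} (a : (Γ(T, ⊤))ˣ) (u : T ⟶ U), Set.range (σ.act a (u ≫ U.ι)) ⊆ U

/-- The restriction of a `𝔾ₘ`-action to a stable open subset. -/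
def GmAction.restrict {S : Scheme.{0}} (σ : GmAction S) {U : S.Opens} (hU : σ.Stable U) :
    GmAction U where
  act a u := IsOpenImmersion.lift U.ι (σ.act a (u ≫ U.ι)) (by simpa using hU a u)
  one_act u := by
    rw [← cancel_mono U.ι, IsOpenImmersion.lift_fac, σ.one_act]
  mul_act a b u := by
    rw [← cancel_mono U.ι, IsOpenImmersion.lift_fac, IsOpenImmersion.lift_fac,
      IsOpenImmersion.lift_fac, σ.mul_act]
  comp_act f a u := by
    rw [← cancel_mono U.ι, Category.assoc, IsOpenImmersion.lift_fac, IsOpenImmersion.lift_fac,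
      σ.comp_act, Category.assoc]

/-- For a `𝔾ₘ`-action on `U`, the action `λ · (u, t) = (λ · u, λⁿ t)` on `U × 𝔾ₐ`. -/
def GmAction.prodGa {U : Scheme.{0}} (σ : GmAction U) (n : ℤ) : GmAction (timesGa U) where
  act a p := timesGa.mk (σ.act a (p ≫ timesGa.fst U)) ((a ^ n).val * timesGa.coord p)
  one_act p := timesGa.ext (by simp [σ.one_act]) (by simp)
  mul_act a b p := timesGa.ext (by simp [σ.mul_act])
    (by simp only [timesGa.coord_mk, mul_zpow, Units.val_mul, mul_assoc])
  comp_act f a p := timesGa.ext (by simp [σ.comp_act]) (by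
    rw [timesGa.coord_comp, timesGa.coord_mk, timesGa.coord_mk, timesGa.coord_comp, map_mul,
      ← map_zpow, Units.coe_map]
    rfl)

/-- The `𝔾ₘ`-action on `X` is a lift of the one on `S` along `ρ : X ⟶ S`. -/
def GmAction.IsLift {X S : Scheme.{0}} (ρ : X ⟶ S) (σ : GmAction S) (σ' : GmAction X) : Prop :=
  σ'.Equivariant σ ρ

/-- The standard grading of `ℂ[x, y]` by the degree. -/
abbrev polyGrading : ℕ → Submodule ℂ PolyRing := MvPolynomial.homogeneousSubmodule (Fin 2) ℂ

instance : GradedAlgebra polyGrading := MvPolynomial.gradedAlgebra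

/-- The projective line `ℙ¹ = Proj ℂ[x, y]`. -/
abbrev projLine : Scheme.{0} := Proj polyGrading

lemma mem_homogeneousCore_iff (I : Ideal PolyRing) {f : PolyRing} {n : ℕ}
    (hf : f ∈ polyGrading n) : f ∈ I.homogeneousCore polyGrading ↔ f ∈ I :=
  ⟨fun h => Ideal.toIdeal_homogeneousCore_le polyGrading I h,
    fun h => Ideal.mem_homogeneousCore_of_homogeneous_of_mem ⟨n, hf⟩ h⟩

/-- The image in `ℙ¹` of a point of `𝔸²_*`: a prime ideal is sent to the prime ideal generated by
its homogeneous elements. -/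
def quotientPoint (p : puncturedPlane) : ProjectiveSpectrum polyGrading where
  asHomogeneousIdeal :=
    (puncturedOpen.ι p : PrimeSpectrum PolyRing).asIdeal.homogeneousCore polyGrading
  isPrime := (puncturedOpen.ι p : PrimeSpectrum PolyRing).isPrime.homogeneousCore
  not_irrelevant_le h := by
    have hX : ∀ i : Fin 2, (MvPolynomial.X i : PolyRing) ∈
        (puncturedOpen.ι p : PrimeSpectrum PolyRing).asIdeal := by
      intro i
      have h1 : (MvPolynomial.X i : PolyRing) ∈ polyGrading 1 := MvPolynomial.isHomogeneous_X ℂ i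
      refine (mem_homogeneousCore_iff _ h1).mp (h ?_)
      rw [HomogeneousIdeal.mem_irrelevant_iff, GradedRing.proj_apply,
        DirectSum.decompose_of_mem_ne polyGrading h1 one_ne_zero]
    rcases p.2 with h | h
    · exact h (hX 0)
    · exact h (hX 1)

lemma continuous_quotientPoint : Continuous quotientPoint := by
  refine (ProjectiveSpectrum.isTopologicalBasis_basic_opens polyGrading).continuous_iff.mpr ?_
  rintro _ ⟨f, rfl⟩
  have : quotientPoint ⁻¹' (ProjectiveSpectrum.basicOpen polyGrading f : Set _) =
      ⋃ i : ℕ, puncturedOpen.ι ⁻¹'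
        (PrimeSpectrum.basicOpen (GradedRing.proj polyGrading i f) :
          Set (PrimeSpectrum PolyRing)) := by
    rw [ProjectiveSpectrum.basicOpen_eq_union_of_projection, Opens.coe_iSup,
      Set.preimage_iUnion]
    refine Set.iUnion_congr fun i => Set.ext fun p => not_congr ?_
    exact mem_homogeneousCore_iff _ (SetLike.coe_mem (DirectSum.decompose polyGrading f i))
  rw [this]
  exact isOpen_iUnion fun i =>
    (PrimeSpectrum.basicOpen (GradedRing.proj polyGrading i f)).2.preimage
      puncturedOpen.ι.continuous

/-- The quotient map `π : 𝔸²_* → ℙ¹` on the underlying topological spaces. -/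
def quotientMap : puncturedPlane.carrier ⟶ projLine.carrier :=
  TopCat.ofHom ⟨quotientPoint, continuous_quotientPoint⟩

/-- The inverse image `π⁻¹(V)` of an open subset `V` of `ℙ¹`. -/
abbrev cone (V : projLine.Opens) : puncturedPlane.Opens := (Opens.map quotientMap).obj V

/-- A polynomial as a regular function on an open subset of `𝔸²_*`. -/
def polyFun (W : puncturedPlane.Opens) : PolyRing →+* Γ(puncturedPlane, W) :=
  (puncturedPlane.presheaf.map (homOfLE (le_top : W ≤ ⊤)).op).hom.comp (pointHom puncturedOpen.ι)

lemma polyFun_restrict {W W' : puncturedPlane.Opens} (h : W' ≤ W) (f : PolyRing) :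
    puncturedPlane.presheaf.map (homOfLE h).op (polyFun W f) = polyFun W' f := by
  have : puncturedPlane.presheaf.map (homOfLE (le_top : W ≤ ⊤)).op ≫
      puncturedPlane.presheaf.map (homOfLE h).op =
      puncturedPlane.presheaf.map (homOfLE (le_top : W' ≤ ⊤)).op := by
    rw [← puncturedPlane.presheaf.map_comp]; rfl
  exact congrArg (fun m => m.hom (pointHom puncturedOpen.ι f)) this

/-- Sections over `V` of Serre's twisting sheaf `𝒪(n)` on `ℙ¹ = Proj ℂ[x, y]`: functions which,
locally on `V`, are quotients `a / b` of homogeneous polynomials with `deg a - deg b = n` and with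
`b` nowhere zero. They are viewed as regular functions on the cone `π⁻¹(V)`, through the natural
inclusion `𝒪(n) ⊆ π_* 𝒪`. -/
def IsTwistSection (n : ℤ) (V : projLine.Opens) (f : Γ(puncturedPlane, cone V)) : Prop :=
  ∀ v ∈ V, ∃ (W : projLine.Opens) (hW : W ≤ V) (i j : ℕ) (a b : PolyRing), v ∈ W ∧
    a ∈ polyGrading i ∧ b ∈ polyGrading j ∧ (i : ℤ) - j = n ∧ W ≤ Proj.basicOpen polyGrading b ∧
    polyFun (cone W) b *
      puncturedPlane.presheaf.map ((Opens.map quotientMap).map (homOfLE hW)).op f =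
        polyFun (cone W) a

/-- Restriction of functions on cones. -/
abbrev coneRes {V W : projLine.Opens} (h : W ≤ V) :
    Γ(puncturedPlane, cone V) →+* Γ(puncturedPlane, cone W) :=
  (puncturedPlane.presheaf.map ((Opens.map quotientMap).map (homOfLE h)).op).hom

lemma coneRes_coneRes {U V W : projLine.Opens} (h : V ≤ U) (k : W ≤ V)
    (f : Γ(puncturedPlane, cone U)) : coneRes k (coneRes h f) = coneRes (k.trans h) f := by
  have : puncturedPlane.presheaf.map ((Opens.map quotientMap).map (homOfLE h)).op ≫
      puncturedPlane.presheaf.map ((Opens.map quotientMap).map (homOfLE k)).op =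
      puncturedPlane.presheaf.map ((Opens.map quotientMap).map (homOfLE (k.trans h))).op := by
    rw [← puncturedPlane.presheaf.map_comp]; rfl
  exact congrArg (fun m => m.hom f) this

lemma coneRes_polyFun {V W : projLine.Opens} (h : W ≤ V) (f : PolyRing) :
    coneRes h (polyFun (cone V) f) = polyFun (cone W) f :=
  polyFun_restrict ((Opens.map quotientMap).map (homOfLE h)).le f

lemma exists_nonvanishing (n : ℤ) (v : projLine) :
    ∃ (i j : ℕ) (b : PolyRing), (i : ℤ) - j = n ∧ b ∈ polyGrading j ∧
      v ∈ Proj.basicOpen polyGrading b := by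
  let w : ProjectiveSpectrum polyGrading := v
  obtain ⟨f, hf, hfw⟩ := SetLike.not_le_iff_exists.mp w.not_irrelevant_le
  obtain ⟨k, hk⟩ : ∃ k : ℕ, (DirectSum.decompose polyGrading f k : PolyRing) ∉
      w.asHomogeneousIdeal.toIdeal := by
    by_contra! H
    refine hfw ?_
    rw [← DirectSum.sum_support_decompose polyGrading f]
    exact Ideal.sum_mem _ fun i _ => H i
  have hk0 : k ≠ 0 := by
    rintro rfl
    rw [HomogeneousIdeal.mem_irrelevant_iff, GradedRing.proj_apply] at hf
    exact hk (hf ▸ zero_mem _)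
  have hle : n.natAbs ≤ n.natAbs * k := Nat.le_mul_of_pos_right _ (Nat.pos_of_ne_zero hk0)
  refine ⟨(n + (n.natAbs * k : ℕ)).toNat, n.natAbs * k,
    (DirectSum.decompose polyGrading f k : PolyRing) ^ n.natAbs, by omega,
    ?_, fun h => hk ?_⟩
  · rw [← smul_eq_mul]
    exact SetLike.pow_mem_graded _ (SetLike.coe_mem (DirectSum.decompose polyGrading f k))
  · exact w.isPrime.mem_of_pow_mem _ h

/-- The sections of `𝒪(n)` over `V` form a group. -/
def twistSections (n : ℤ) (V : projLine.Opens) : AddSubgroup Γ(puncturedPlane, cone V) where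
  carrier := {f | IsTwistSection n V f}
  zero_mem' v hv := by
    obtain ⟨i, j, b, h, hb, hvb⟩ := exists_nonvanishing n v
    refine ⟨V ⊓ Proj.basicOpen polyGrading b, inf_le_left, i, j, 0, b, ⟨hv, hvb⟩, zero_mem _, hb,
      h, inf_le_right, ?_⟩
    rw [map_zero, map_zero, mul_zero]
  add_mem' {f g} hf hg v hv := by
    obtain ⟨W, hW, i, j, a, b, hv1, ha, hb, hn, hWb, e⟩ := hf v hv
    obtain ⟨W', hW', i', j', a', b', hv2, ha', hb', hn', hWb', e'⟩ := hg v hv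
    refine ⟨W ⊓ W', inf_le_left.trans hW, i + j', j + j', a * b' + a' * b, b * b', ⟨hv1, hv2⟩,
      ?_, ?_, by push_cast; omega, ?_, ?_⟩
    · refine add_mem (SetLike.mul_mem_graded ha hb') ?_
      have : i + j' = i' + j := by omega
      rw [this]
      exact SetLike.mul_mem_graded ha' hb
    · exact SetLike.mul_mem_graded hb hb'
    · rw [Proj.basicOpen_mul]
      exact inf_le_inf hWb hWb'
    · have e1 := congrArg (coneRes (inf_le_left : W ⊓ W' ≤ W)) e
      have e2 := congrArg (coneRes (inf_le_right : W ⊓ W' ≤ W')) e'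
      rw [map_mul, coneRes_polyFun, coneRes_polyFun] at e1 e2
      erw [coneRes_coneRes] at e1 e2
      change polyFun _ (b * b') * coneRes _ (f + g) = _
      rw [map_mul, map_add, map_add, map_mul, map_mul, ← e1, ← e2]
      ring
  neg_mem' {f} hf v hv := by
    obtain ⟨W, hW, i, j, a, b, hv1, ha, hb, hn, hWb, e⟩ := hf v hv
    refine ⟨W, hW, i, j, -a, b, hv1, neg_mem ha, hb, hn, hWb, ?_⟩
    rw [map_neg, map_neg, mul_neg, e]

lemma twistSections_restrict (n : ℤ) {V W : projLine.Opens} (h : W ≤ V) :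
    twistSections n V ≤ (twistSections n W).comap (coneRes h).toAddMonoidHom := by
  intro f hf v hv
  obtain ⟨W', hW', i, j, a, b, hv1, ha, hb, hn, hWb, e⟩ := hf v (h hv)
  refine ⟨W ⊓ W', inf_le_left, i, j, a, b, ⟨hv, hv1⟩, ha, hb, hn, inf_le_right.trans hWb, ?_⟩
  have e1 := congrArg (coneRes (inf_le_right : W ⊓ W' ≤ W')) e
  rw [map_mul, coneRes_polyFun, coneRes_polyFun] at e1
  erw [coneRes_coneRes] at e1
  rw [← e1]
  congr 1

/-- The twisting sheaf `𝒪(n)` on `ℙ¹`, as a sheaf of abelian groups. -/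
def twistingSheaf (n : ℤ) : TopCat.Presheaf AddCommGrpCat.{0} projLine.carrier where
  obj V := AddCommGrpCat.of (twistSections n V.unop)
  map {V W} h := AddCommGrpCat.ofHom
    (((coneRes h.unop.le).toAddMonoidHom.comp (twistSections n V.unop).subtype).codRestrict
      (twistSections n W.unop) fun f => twistSections_restrict n h.unop.le f.2)
  map_id V := by
    ext f
    exact congrArg (fun m => m.hom f.1) (puncturedPlane.presheaf.map_id (op (cone V.unop)))
  map_comp {U V W} h k := by
    ext f
    exact (coneRes_coneRes _ _ f.1).symm

/-- The inclusion `𝒪(n) ⟶ π_* 𝒪` of sheaves on `ℙ¹`. -/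
def twistInclusion (n : ℤ) : twistingSheaf n ⟶
    (TopCat.Presheaf.pushforward _ quotientMap).obj (addStructureSheaf puncturedPlane) where
  app V := AddCommGrpCat.ofHom (twistSections n V.unop).subtype
  naturality V W h := by
    ext f
    rfl

/-- The natural map `H¹(ℙ¹, 𝒪(n)) → H¹(ℙ¹, π_* 𝒪) ≅ H¹(𝔸²_*, 𝒪)`. -/
def twistH1Map (n : ℤ) :
    CechH1 (twistingSheaf n) →+ CechH1 (addStructureSheaf puncturedPlane) :=
  cechH1Map quotientMap (twistInclusion n)

/-- Condition on a `𝔾ₐ`-bundle `E` over `𝔸²_*` and an integer `n`: the `𝔾ₘ`-action `σ` on `𝔸²_*`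
admits a lift `σ'` to `E`, and `𝔸²_*` is covered by `𝔾ₘ`-stable affine open subsets over which `E`
has `𝔾ₐ`-equivariant trivializations which are `𝔾ₘ`-equivariant for `σ'` and the action
`λ · (u, t) = (σ(λ, u), λⁿ t)`. -/
def HasHomogeneousLift (n : ℤ) (E : GaBundle puncturedPlane) : Prop :=
  ∃ σ' : GmAction E.X, scalarAction.IsLift E.ρ σ' ∧
    ∃ (I : Type) (U : I → puncturedPlane.Opens) (hU : ∀ i, scalarAction.Stable (U i))
      (τ : ∀ i, GaTrivialization E.ρ E.action (U i)),
      ⨆ i, U i = ⊤ ∧ (∀ i, IsAffineOpen (U i)) ∧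
      ∀ i, ((scalarAction.restrict (hU i)).prodGa n).Equivariant σ' (τ i).hom

end

noncomputable section

/-! ### Points with image in an open subset -/

section LiftOpen

variable {S T T' : Scheme.{0}}

/-! Put `n = -d`. The point is that a lift of the scaling action which multiplies fibre coordinates
by `λⁿ` amounts to homogeneous transition functions. If both `t_i` and `t_j` are multiplied by `λⁿ`,
then so is `h_ij = t_i - t_j`, that is, `h_ij(λu) = λⁿ h_ij(u)` (`isHomogeneous_transition`).
Conversely, if all `h_ij` have this property, the local actions `(u, t) ↦ (λu, λⁿt)` agree on
overlaps and glue to an action on the bundle (`exists_lift`).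

This translates to `ℙ¹` by two facts. The `𝔾ₘ`-stable open subsets of the punctured plane are
exactly the cones `π⁻¹(V)` (`stable_cone`, `exists_eq_cone`), and the homogeneous functions of
degree `n` on a cone are exactly the sections of `𝒪(n)` (`IsTwistSection.isHomogeneous`,
`isTwistSection_of_isHomogeneous`). Equivariant trivializations therefore produce a Čech cocycle of
`𝒪(n)` whose image is the cocycle of the bundle.

For the other implication, equality of classes only says that the cocycle of the bundle and a
cocycle of `𝒪(n)` become cohomologous on some finer covering, whose members need not be stable,
through functions that need not be homogeneous. `exists_trivializations` repairs this: the bundle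
itself has trivializations over the original cones with the given homogeneous cocycle as transition
functions. Starting from a covering of `ℙ¹` by suitable basic open subsets makes these cones affine.

Actions are given on `T`-valued points, so identities are checked by evaluating functions (`evalAt`)
and fibre coordinates (`fibreCoord`) at such points. To detect homogeneity, a point is scaled by an
indeterminate `X` over its residue field (`exists_generic_point`): the homogeneous components of a
polynomial then appear as the coefficients of a polynomial in `X`. -/

lemma liftOpen_range {q : T ⟶ S} {U : S.Opens} (h : ∀ t, q t ∈ U) :
    Set.range q ⊆ Set.range U.ι := by
  rintro _ ⟨t, rfl⟩
  rw [Scheme.Opens.range_ι]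
  exact h t

/-- A `T`-point of `S` with image in `U`, as a `T`-point of `U`. -/
def liftOpen (q : T ⟶ S) (U : S.Opens) (h : ∀ t, q t ∈ U) : T ⟶ U :=
  IsOpenImmersion.lift U.ι q (liftOpen_range h)

@[simp] lemma liftOpen_ι (q : T ⟶ S) (U : S.Opens) (h : ∀ t, q t ∈ U) :
    liftOpen q U h ≫ U.ι = q :=
  IsOpenImmersion.lift_fac _ _ _

lemma comp_liftOpen (f : T' ⟶ T) (q : T ⟶ S) (U : S.Opens) (h : ∀ t, q t ∈ U)
    (h' : ∀ t, (f ≫ q) t ∈ U) : f ≫ liftOpen q U h = liftOpen (f ≫ q) U h' := by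
  rw [← cancel_mono U.ι, Category.assoc, liftOpen_ι, liftOpen_ι]

lemma comp_ι_mem {U : S.Opens} (u : T ⟶ U) (t : T) : (u ≫ U.ι) t ∈ U := (u t).2

end LiftOpen

/-! ### Gluing morphisms of schemes over an open covering of the base -/

section Gluing

variable {S T X : Scheme.{0}} {I : Type} {U : I → S.Opens}

lemma isOpenCover_preimage (q : T ⟶ S) (hU : ∀ s, ∃ i, s ∈ U i) :
    IsOpenCover fun i => q ⁻¹ᵁ U i := by
  refine IsOpenCover.mk (top_le_iff.mp fun t _ => ?_)
  obtain ⟨i, hi⟩ := hU (q t)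
  exact Opens.mem_iSup.mpr ⟨i, hi⟩

/-- Two morphisms agree if they agree locally over the base. -/
lemma hom_ext_over (q : T ⟶ S) (hU : ∀ s, ∃ i, s ∈ U i) {f g : T ⟶ X}
    (h : ∀ (i : I) {Z : Scheme.{0}} (a : Z ⟶ T), (∀ z, (a ≫ q) z ∈ U i) → a ≫ f = a ≫ g) :
    f = g := by
  refine (T.openCoverOfIsOpenCover _ (isOpenCover_preimage q hU)).hom_ext _ _ fun i => ?_
  exact h i (q ⁻¹ᵁ U i).ι fun z => z.2

/-- Two global functions agree if they agree locally over the base. -/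
lemma section_ext_over (q : T ⟶ S) (hU : ∀ s, ∃ i, s ∈ U i) {f g : Γ(T, ⊤)}
    (h : ∀ (i : I) {Z : Scheme.{0}} (a : Z ⟶ T), (∀ z, (a ≫ q) z ∈ U i) →
      a.appTop f = a.appTop g) : f = g := by
  -- A global function is the same as a section of `timesGa T`, so the statement for morphisms
  -- applies.
  have key : timesGa.mk (𝟙 T) f = timesGa.mk (𝟙 T) g := by
    refine hom_ext_over q hU fun i Z a ha => timesGa.ext (by simp) ?_
    rw [timesGa.coord_comp, timesGa.coord_comp, timesGa.coord_mk, timesGa.coord_mk, h i a ha]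
  simpa using congrArg timesGa.coord key

/-- Morphisms which are given locally over the base, compatibly, can be glued. -/
lemma exists_glue_over (q : T ⟶ S) (hU : ∀ s, ∃ i, s ∈ U i)
    (f : ∀ (i : I) {Z : Scheme.{0}} (a : Z ⟶ T), (∀ z, (a ≫ q) z ∈ U i) → (Z ⟶ X))
    (comp : ∀ (i : I) {Z Z' : Scheme.{0}} (b : Z' ⟶ Z) (a : Z ⟶ T) (h : ∀ z, (a ≫ q) z ∈ U i)
      (h' : ∀ z, ((b ≫ a) ≫ q) z ∈ U i), b ≫ f i a h = f i (b ≫ a) h')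
    (compat : ∀ (i j : I) {Z : Scheme.{0}} (a : Z ⟶ T) (h : ∀ z, (a ≫ q) z ∈ U i)
      (h' : ∀ z, (a ≫ q) z ∈ U j), f i a h = f j a h') :
    ∃ F : T ⟶ X, ∀ (i : I) {Z : Scheme.{0}} (a : Z ⟶ T) (h : ∀ z, (a ≫ q) z ∈ U i),
      a ≫ F = f i a h := by
  let 𝒰 := T.openCoverOfIsOpenCover _ (isOpenCover_preimage q hU)
  have h𝒰 : ∀ i (z : 𝒰.X i), (𝒰.f i ≫ q) z ∈ U i := fun i z => z.2
  let F : T ⟶ X := 𝒰.glueMorphisms (fun i => f i (𝒰.f i) (h𝒰 i)) fun i j => by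
    have h1 : ∀ z, ((Limits.pullback.fst (𝒰.f i) (𝒰.f j) ≫ 𝒰.f i) ≫ q) z ∈ U i := fun z =>
      h𝒰 i (Limits.pullback.fst (𝒰.f i) (𝒰.f j) z)
    have h2 : ∀ z, ((Limits.pullback.snd (𝒰.f i) (𝒰.f j) ≫ 𝒰.f j) ≫ q) z ∈ U j := fun z =>
      h𝒰 j (Limits.pullback.snd (𝒰.f i) (𝒰.f j) z)
    rw [comp i _ _ _ h1, comp j _ _ _ h2]
    have e := Limits.pullback.condition (f := 𝒰.f i) (g := 𝒰.f j)
    -- The membership proofs mention the composite that is about to be rewritten.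
    revert h1 h2
    rw [e]
    intro h1 h2
    exact compat i j _ h1 h2
  refine ⟨F, fun i Z a h => ?_⟩
  obtain ⟨b, rfl⟩ : ∃ b, a = b ≫ 𝒰.f i :=
    ⟨liftOpen a (q ⁻¹ᵁ U i) h, (liftOpen_ι _ _ _).symm⟩
  have hF : 𝒰.f i ≫ F = f i (𝒰.f i) (h𝒰 i) := 𝒰.ι_glueMorphisms _ _ i
  exact (Category.assoc _ _ _).trans ((congrArg (b ≫ ·) hF).trans (comp i b (𝒰.f i) (h𝒰 i) h))

end Gluing

/-! ### Values of regular functions at points with values in a scheme -/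

section Evaluation

variable {S T T' : Scheme.{0}}

/-- The value of a regular function on `U` at a `T`-point of `U`. -/
def evalAt (q : T ⟶ S) (U : S.Opens) (h : ∀ t, q t ∈ U) : Γ(S, U) →+* Γ(T, ⊤) :=
  (q.appLE U ⊤ fun t _ => h t).hom

lemma forall_mem_inf {q : T ⟶ S} {U V : S.Opens} (h : ∀ t, q t ∈ U) (h' : ∀ t, q t ∈ V) :
    ∀ t, q t ∈ U ⊓ V :=
  fun t => ⟨h t, h' t⟩

lemma forall_comp_mem (f : T' ⟶ T) {q : T ⟶ S} {U : S.Opens} (h : ∀ t, q t ∈ U) :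
    ∀ t, (f ≫ q) t ∈ U :=
  fun t => h (f t)

lemma evalAt_congr {q q' : T ⟶ S} (e : q = q') {U : S.Opens} (h : ∀ t, q t ∈ U)
    (s : Γ(S, U)) : evalAt q U h s = evalAt q' U (e ▸ h) s := by
  subst e
  rfl

lemma evalAt_comp (f : T' ⟶ T) (q : T ⟶ S) {U : S.Opens} (h : ∀ t, q t ∈ U)
    (h' : ∀ t, (f ≫ q) t ∈ U) (s : Γ(S, U)) :
    evalAt (f ≫ q) U h' s = f.appTop (evalAt q U h s) := by
  have := Scheme.Hom.appLE_comp_appLE f q U ⊤ ⊤ (fun t _ => h t) (fun t _ => trivial)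
  have h2 : f.appLE ⊤ ⊤ (fun t _ => trivial) = f.appTop := Scheme.Hom.appLE_eq_app (f := f) (U := ⊤)
  rw [h2] at this
  exact congrArg (fun m => m.hom s) this.symm

lemma evalAt_map (q : T ⟶ S) {U V : S.Opens} (k : V ⟶ U) (h : ∀ t, q t ∈ V)
    (h' : ∀ t, q t ∈ U) (s : Γ(S, U)) :
    evalAt q V h (S.presheaf.map k.op s) = evalAt q U h' s :=
  congrArg (fun m : Γ(S, U) ⟶ Γ(T, ⊤) => m.hom s)
    (Scheme.Hom.map_appLE q (V := ⊤) (fun t _ => h t) k.op)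

lemma evalAt_top (q : T ⟶ S) (s : Γ(S, ⊤)) : evalAt q ⊤ (fun _ => trivial) s = q.appTop s :=
  congrArg (fun m => m.hom s) (Scheme.Hom.appLE_eq_app (f := q) (U := ⊤))

lemma evalAt_ι (U : S.Opens) (s : Γ(S, U)) :
    evalAt U.ι U (fun u => u.2) s = U.topIso.inv s := by
  have : U.ι.appLE U ⊤ (fun u _ => u.2) = U.topIso.inv := by
    refine (Scheme.Opens.ι_appLE U U ⊤ _).trans ?_
    rw [Scheme.Opens.topIso_inv]
    rfl
  exact congrArg (fun m => m.hom s) this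

/-- The inclusion `U.ι` is the universal point of `U`: evaluation there is the isomorphism
`U.topIso.inv`, so this single value determines the function. -/
lemma ext_evalAt {U : S.Opens} {s s' : Γ(S, U)}
    (h : ∀ {T : Scheme.{0}} (q : T ⟶ S) (hq : ∀ t, q t ∈ U), evalAt q U hq s = evalAt q U hq s') :
    s = s' := by
  have := h U.ι fun u => u.2
  rw [evalAt_ι, evalAt_ι] at this
  have inv_hom : ∀ s, U.topIso.hom (U.topIso.inv s) = s := fun s =>
    congrArg (fun m => m.hom s) U.topIso.inv_hom_id
  rw [← inv_hom s, this, inv_hom]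

end Evaluation

/-! ### Fibre coordinates of points with values in a scheme -/

namespace timesGa

lemma comp_mk {U T T' : Scheme.{0}} (f : T' ⟶ T) (u : T ⟶ U) (c : Γ(T, ⊤)) :
    f ≫ mk u c = mk (f ≫ u) (f.appTop c) :=
  ext (by simp) (by simp [coord_comp])

end timesGa

namespace GaTrivialization

variable {X S T T' : Scheme.{0}} {ρ : X ⟶ S} {α : GaAction X} {U : S.Opens}

/-- The fibre coordinate of a `T`-point of `X` lying over `U`. -/
def fibreCoord (τ : GaTrivialization ρ α U) (p : T ⟶ X) (h : ∀ t, (p ≫ ρ) t ∈ U) : Γ(T, ⊤) :=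
  τ.coord p (liftOpen (p ≫ ρ) U h) (liftOpen_ι _ _ _).symm

/-- The `T`-point of `X` over a `T`-point `q` of `U` with fibre coordinate `c`. -/
def point (τ : GaTrivialization ρ α U) (q : T ⟶ S) (h : ∀ t, q t ∈ U) (c : Γ(T, ⊤)) : T ⟶ X :=
  timesGa.mk (liftOpen q U h) c ≫ τ.hom

@[simp] lemma point_ρ (τ : GaTrivialization ρ α U) (q : T ⟶ S) (h : ∀ t, q t ∈ U)
    (c : Γ(T, ⊤)) : τ.point q h c ≫ ρ = q := by
  rw [point, Category.assoc, τ.isPullback.w, ← Category.assoc, timesGa.mk_fst, liftOpen_ι]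

lemma comp_point (τ : GaTrivialization ρ α U) (f : T' ⟶ T) (q : T ⟶ S) (h : ∀ t, q t ∈ U)
    (h' : ∀ t, (f ≫ q) t ∈ U) (c : Γ(T, ⊤)) :
    f ≫ τ.point q h c = τ.point (f ≫ q) h' (f.appTop c) := by
  rw [point, point, ← Category.assoc, timesGa.comp_mk, comp_liftOpen]

lemma fibreCoord_comp (τ : GaTrivialization ρ α U) (f : T' ⟶ T) (p : T ⟶ X)
    (h : ∀ t, (p ≫ ρ) t ∈ U) (h' : ∀ t, ((f ≫ p) ≫ ρ) t ∈ U) :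
    τ.fibreCoord (f ≫ p) h' = f.appTop (τ.fibreCoord p h) := by
  rw [fibreCoord, fibreCoord, ← coord_comp]
  · congr 1
    rw [← cancel_mono U.ι]
    simp
  · simp

lemma coord_hom (τ : GaTrivialization ρ α U) (m : T ⟶ timesGa U) (u : T ⟶ U)
    (h : (m ≫ τ.hom) ≫ ρ = u ≫ U.ι) : τ.coord (m ≫ τ.hom) u h = timesGa.coord m := by
  have hm : m ≫ timesGa.fst U = u := by
    rw [← cancel_mono U.ι, ← h, Category.assoc, Category.assoc, τ.isPullback.w]
  rw [coord]
  congr 1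
  apply τ.isPullback.hom_ext
  · erw [lift_hom]
  · erw [lift_fst, hm]

@[simp] lemma fibreCoord_point (τ : GaTrivialization ρ α U) (q : T ⟶ S) (h : ∀ t, q t ∈ U)
    (c : Γ(T, ⊤)) (h' : ∀ t, (τ.point q h c ≫ ρ) t ∈ U) :
    τ.fibreCoord (τ.point q h c) h' = c := by
  rw [fibreCoord]
  exact (τ.coord_hom _ _ _).trans (timesGa.coord_mk _ _)

lemma point_fibreCoord (τ : GaTrivialization ρ α U) (p : T ⟶ X) (h : ∀ t, (p ≫ ρ) t ∈ U) :
    τ.point (p ≫ ρ) h (τ.fibreCoord p h) = p := by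
  rw [point, fibreCoord, coord]
  have : timesGa.mk (liftOpen (p ≫ ρ) U h)
      (timesGa.coord (τ.lift p (liftOpen (p ≫ ρ) U h) (liftOpen_ι _ _ _).symm)) =
      τ.lift p (liftOpen (p ≫ ρ) U h) (liftOpen_ι _ _ _).symm :=
    timesGa.ext (by simp) (by simp)
  rw [this, lift_hom]

lemma eq_of_fibreCoord_eq (τ : GaTrivialization ρ α U) {p p' : T ⟶ X}
    (e : p ≫ ρ = p' ≫ ρ) (h : ∀ t, (p ≫ ρ) t ∈ U) (h' : ∀ t, (p' ≫ ρ) t ∈ U)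
    (hc : τ.fibreCoord p h = τ.fibreCoord p' h') : p = p' := by
  rw [← τ.point_fibreCoord p h, ← τ.point_fibreCoord p' h', hc]
  congr 1

lemma fibreCoord_act (τ : GaTrivialization ρ α U) (a : Γ(T, ⊤)) (p : T ⟶ X)
    (e : α.act a p ≫ ρ = p ≫ ρ) (h : ∀ t, (p ≫ ρ) t ∈ U)
    (h' : ∀ t, (α.act a p ≫ ρ) t ∈ U) :
    τ.fibreCoord (α.act a p) h' = τ.fibreCoord p h + a := by
  rw [fibreCoord, fibreCoord, ← τ.coord_act a p]
  · congr 1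
    congr 1
  · rw [e, liftOpen_ι]

end GaTrivialization

namespace GaBundle

variable {S : Scheme.{0}} {E : GaBundle S} {U V : S.Opens}

lemma exists_trivialization (E : GaBundle S) : ∀ s, ∃ i : S, s ∈ E.cover.nhd i :=
  fun s => ⟨s, E.cover.mem_nhd s⟩

/-- The transition function is the difference of the fibre coordinates. -/
lemma evalAt_transition (τ : GaTrivialization E.ρ E.action U)
    (τ' : GaTrivialization E.ρ E.action V) {T : Scheme.{0}} (p : T ⟶ E.X)
    (h : ∀ t, (p ≫ E.ρ) t ∈ U ⊓ V) :
    evalAt (p ≫ E.ρ) (U ⊓ V) h (transition τ τ') =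
      τ.fibreCoord p (fun t => (h t).1) - τ'.fibreCoord p (fun t => (h t).2) := by
  have hz : (S.homOfLE (inf_le_right : U ⊓ V ≤ V) ≫ τ'.zeroSection) ≫ E.ρ = (U ⊓ V).ι := by
    rw [Category.assoc, τ'.zeroSection_ρ, Scheme.homOfLE_ι]
  -- By definition the transition function is the `τ`-coordinate of this section `z`, whose
  -- `τ'`-coordinate is zero. An arbitrary `p` is the translate of a pullback of `z` by the
  -- `τ'`-coordinate of `p`, and translation adds the same function to the `τ`-coordinate.
  set z : (U ⊓ V).toScheme ⟶ E.X := S.homOfLE (inf_le_right : U ⊓ V ≤ V) ≫ τ'.zeroSection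
  have hzU : ∀ t, (z ≫ E.ρ) t ∈ U := fun t => by rw [hz]; exact t.2.1
  have hzV : ∀ t, (z ≫ E.ρ) t ∈ V := fun t => by rw [hz]; exact t.2.2
  set u : T ⟶ (U ⊓ V).toScheme := liftOpen (p ≫ E.ρ) (U ⊓ V) h
  have hu : (u ≫ z) ≫ E.ρ = p ≫ E.ρ := by rw [Category.assoc, hz, liftOpen_ι]
  have e1 : transition τ τ' = (U ⊓ V).topIso.hom (τ.fibreCoord z hzU) := by
    rw [transition, GaTrivialization.fibreCoord]
    congr 2
    rw [← cancel_mono U.ι, liftOpen_ι, hz, Scheme.homOfLE_ι]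
  have e2 : τ'.fibreCoord z hzV = 0 := by
    have : z = (S.homOfLE (inf_le_right : U ⊓ V ≤ V) ≫ timesGa.mk (𝟙 _) 0) ≫ τ'.hom :=
      (Category.assoc _ _ _).symm
    rw [GaTrivialization.fibreCoord]
    have hh := τ'.coord_hom (S.homOfLE (inf_le_right : U ⊓ V ≤ V) ≫ timesGa.mk (𝟙 _) 0)
      (liftOpen (z ≫ E.ρ) V hzV) (by rw [← this, liftOpen_ι])
    refine Eq.trans ?_ (hh.trans ?_)
    · congr 1
    · rw [timesGa.coord_comp, timesGa.coord_mk, map_zero]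
  have e3 : evalAt (p ≫ E.ρ) (U ⊓ V) h (transition τ τ') = u.appTop (τ.fibreCoord z hzU) := by
    have hp : p ≫ E.ρ = u ≫ (U ⊓ V).ι := (liftOpen_ι _ _ _).symm
    have : evalAt (p ≫ E.ρ) (U ⊓ V) h (transition τ τ') =
        evalAt (u ≫ (U ⊓ V).ι) (U ⊓ V) (comp_ι_mem u) (transition τ τ') := by
      congr 2
    rw [this, evalAt_comp u (U ⊓ V).ι (fun t : (U ⊓ V).toScheme => t.2), evalAt_ι, e1]
    congr 1
    exact congrArg (fun m => m.hom (τ.fibreCoord z hzU)) (U ⊓ V).topIso.hom_inv_id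
  have hu1 : ∀ t, ((u ≫ z) ≫ E.ρ) t ∈ U := fun t => by rw [hu]; exact (h t).1
  have hu2 : ∀ t, ((u ≫ z) ≫ E.ρ) t ∈ V := fun t => by rw [hu]; exact (h t).2
  set a := τ'.fibreCoord p (fun t => (h t).2)
  have e4 : p = E.action.act a (u ≫ z) := by
    refine τ'.eq_of_fibreCoord_eq (by rw [E.act_ρ, hu]) (fun t => (h t).2)
      (fun t => by rw [E.act_ρ]; exact hu2 t) ?_
    rw [τ'.fibreCoord_act _ _ (E.act_ρ _ _) hu2, τ'.fibreCoord_comp _ _ hzV, e2, map_zero,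
      zero_add]
  have e5 : τ.fibreCoord p (fun t => (h t).1) = τ.fibreCoord (E.action.act a (u ≫ z))
      (fun t => by rw [E.act_ρ]; exact hu1 t) := by
    congr 1
  rw [e3, e5, τ.fibreCoord_act _ _ (E.act_ρ _ _) hu1, τ.fibreCoord_comp _ _ hzU, add_sub_cancel_right]

/-- A characterization of the transition function. -/
lemma transition_eq (τ : GaTrivialization E.ρ E.action U)
    (τ' : GaTrivialization E.ρ E.action V) {g : Γ(S, U ⊓ V)}
    (H : ∀ {T : Scheme.{0}} (p : T ⟶ E.X) (h : ∀ t, (p ≫ E.ρ) t ∈ U ⊓ V),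
      τ.fibreCoord p (fun t => (h t).1) - τ'.fibreCoord p (fun t => (h t).2) =
        evalAt (p ≫ E.ρ) (U ⊓ V) h g) : transition τ τ' = g := by
  refine ext_evalAt fun {T} q hq => ?_
  obtain ⟨p, rfl⟩ : ∃ p, q = p ≫ E.ρ := ⟨τ.point q (fun t => (hq t).1) 0, by simp⟩
  rw [evalAt_transition, H]

end GaBundle

/-! ### Trivializations and sections of `𝔾ₐ`-bundles -/

namespace GaBundle

variable {S : Scheme.{0}} (E : GaBundle S) {U V : S.Opens} {T : Scheme.{0}}

/-- Two points of a bundle in the same fibre differ by a translation. -/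
lemma exists_act_eq (p p' : T ⟶ E.X) (e : p ≫ E.ρ = p' ≫ E.ρ) :
    ∃ c, E.action.act c p' = p := by
  have hl : ∀ {i : S} {Z : Scheme.{0}} {a : Z ⟶ T}, (∀ z, (a ≫ p ≫ E.ρ) z ∈ E.cover.nhd i) →
      ∀ z, ((a ≫ p) ≫ E.ρ) z ∈ E.cover.nhd i := fun h => by simpa using h
  have hl' : ∀ {i : S} {Z : Scheme.{0}} {a : Z ⟶ T}, (∀ z, (a ≫ p ≫ E.ρ) z ∈ E.cover.nhd i) →
      ∀ z, ((a ≫ p') ≫ E.ρ) z ∈ E.cover.nhd i := fun h => by rw [e] at h; simpa using h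
  -- Locally `c` is the difference of the fibre coordinates of `p` and `p'`. It does not depend on
  -- the trivialization, since the transition function depends only on the common base point and
  -- cancels. Functions are encoded as maps to `timesGa T` so that they can be glued.
  obtain ⟨F, hF⟩ := exists_glue_over (X := timesGa T) (p ≫ E.ρ) E.exists_trivialization
    (fun i Z a h => timesGa.mk a ((E.trivialization i).fibreCoord (a ≫ p) (hl h) -
      (E.trivialization i).fibreCoord (a ≫ p') (hl' h)))
    (fun i Z Z' b a h h' => by
      rw [timesGa.comp_mk, map_sub]
      congr 2
      · rw [← (E.trivialization i).fibreCoord_comp b (a ≫ p) (hl h) (by simpa using h')]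
        congr 1
      · rw [← (E.trivialization i).fibreCoord_comp b (a ≫ p') (hl' h)
          (by rw [e] at h'; simpa using h')]
        congr 1)
    (fun i j Z a h h' => by
      congr 1
      have h1 := evalAt_transition (E.trivialization i) (E.trivialization j) (a ≫ p)
        (forall_mem_inf (hl h) (hl h'))
      have h2 := evalAt_transition (E.trivialization i) (E.trivialization j) (a ≫ p')
        (forall_mem_inf (hl' h) (hl' h'))
      have ha : (a ≫ p) ≫ E.ρ = (a ≫ p') ≫ E.ρ := by simp [e]
      rw [evalAt_congr ha, h2] at h1
      linear_combination -h1)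
  refine ⟨timesGa.coord F, hom_ext_over (p ≫ E.ρ) E.exists_trivialization fun i Z a h => ?_⟩
  rw [E.action.comp_act, ← timesGa.coord_comp, hF i a h, timesGa.coord_mk]
  refine (E.trivialization i).eq_of_fibreCoord_eq ?_ (fun z => ?_) (hl h) ?_
  · rw [E.act_ρ, Category.assoc, Category.assoc, e]
  · rw [E.act_ρ]
    exact hl' h z
  · rw [(E.trivialization i).fibreCoord_act _ _ (E.act_ρ _ _) (hl' h)]
    ring

/-- Freeness of the action is local on the base, and in a trivialization the action is addition on
the fibre coordinate, which can be cancelled. -/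
lemma act_injective (p : T ⟶ E.X) {c c' : Γ(T, ⊤)} (h : E.action.act c p = E.action.act c' p) :
    c = c' := by
  refine section_ext_over (p ≫ E.ρ) E.exists_trivialization fun i Z a ha => ?_
  have hp : ∀ z, ((a ≫ p) ≫ E.ρ) z ∈ E.cover.nhd i := by simpa using ha
  have hp' : ∀ (c : Γ(Z, ⊤)) z, (E.action.act c (a ≫ p) ≫ E.ρ) z ∈ E.cover.nhd i := by
    intro c
    rw [E.act_ρ]
    exact hp
  have h1 := congrArg (a ≫ ·) h
  simp only [E.action.comp_act] at h1
  have h2 : (E.trivialization i).fibreCoord _ (hp' (a.appTop c)) =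
      (E.trivialization i).fibreCoord _ (hp' (a.appTop c')) := by
    congr 1
  rw [(E.trivialization i).fibreCoord_act _ _ (E.act_ρ _ _) hp,
    (E.trivialization i).fibreCoord_act _ _ (E.act_ρ _ _) hp] at h2
  exact add_left_cancel h2

/-- The map `(u, t) ↦ e(u) + t` defined by a section `e`. -/
def sectionHom (e : U.toScheme ⟶ E.X) : timesGa U ⟶ E.X :=
  E.action.act (timesGa.coord (𝟙 (timesGa U))) (timesGa.fst U ≫ e)

lemma comp_sectionHom (e : U.toScheme ⟶ E.X) (m : T ⟶ timesGa U) :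
    m ≫ E.sectionHom e = E.action.act (timesGa.coord m) ((m ≫ timesGa.fst U) ≫ e) := by
  rw [sectionHom, E.action.comp_act, ← timesGa.coord_comp, Category.comp_id, Category.assoc]

/-- This is the torsor property: `exists_act_eq` provides the coordinate of a point relative to `e`,
and `act_injective` its uniqueness. -/
lemma sectionHom_isPullback (e : U.toScheme ⟶ E.X) (he : e ≫ E.ρ = U.ι) :
    IsPullback (E.sectionHom e) (timesGa.fst U) E.ρ U.ι := by
  have w : E.sectionHom e ≫ E.ρ = timesGa.fst U ≫ U.ι := by
    rw [sectionHom, E.act_ρ, Category.assoc, he]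
  have ex : ∀ s : Limits.PullbackCone E.ρ U.ι,
      ∃ c, E.action.act c (s.snd ≫ e) = s.fst := fun s =>
    E.exists_act_eq _ _ (by rw [Category.assoc, he, s.condition])
  refine ⟨⟨w⟩, ⟨Limits.PullbackCone.IsLimit.mk w
    (fun s => timesGa.mk s.snd (ex s).choose) (fun s => ?_) (fun s => ?_) (fun s m h1 h2 => ?_)⟩⟩
  · rw [comp_sectionHom, timesGa.coord_mk, timesGa.mk_fst]
    exact (ex s).choose_spec
  · exact timesGa.mk_fst _ _
  · refine timesGa.ext (by rw [timesGa.mk_fst]; exact h2) ?_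
    rw [timesGa.coord_mk]
    refine E.act_injective (s.snd ≫ e) ?_
    rw [(ex s).choose_spec, ← h1, comp_sectionHom]
    exact congrArg (fun v => E.action.act (timesGa.coord m) (v ≫ e)) h2.symm

/-- The trivialization given by a section. -/
def ofSection (e : U.toScheme ⟶ E.X) (he : e ≫ E.ρ = U.ι) :
    GaTrivialization E.ρ E.action U where
  hom := E.sectionHom e
  isPullback := E.sectionHom_isPullback e he
  equivariant {T} a p := by
    rw [comp_sectionHom, comp_sectionHom, ← E.action.add_act]
    simp only [timesGa.translation, timesGa.coord_mk, timesGa.mk_fst]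
    rw [add_comm]

variable {E}

/-- A point is the translate of `e` by its coordinate relative to `e`, and `τ`-coordinates add under
translation; the new coordinate is the old one with the origin moved to `e`. -/
lemma fibreCoord_ofSection (e : U.toScheme ⟶ E.X) (he : e ≫ E.ρ = U.ι)
    (τ : GaTrivialization E.ρ E.action V) (p : T ⟶ E.X) (h : ∀ t, (p ≫ E.ρ) t ∈ U)
    (h' : ∀ t, (p ≫ E.ρ) t ∈ V)
    (h'' : ∀ t, ((liftOpen (p ≫ E.ρ) U h ≫ e) ≫ E.ρ) t ∈ V) :
    (E.ofSection e he).fibreCoord p h =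
      τ.fibreCoord p h' - τ.fibreCoord (liftOpen (p ≫ E.ρ) U h ≫ e) h'' := by
  have key : E.action.act ((E.ofSection e he).fibreCoord p h)
      (liftOpen (p ≫ E.ρ) U h ≫ e) = p := by
    conv_rhs => rw [← (E.ofSection e he).point_fibreCoord p h]
    rw [GaTrivialization.point]
    erw [comp_sectionHom]
    rw [timesGa.coord_mk, timesGa.mk_fst]
  have h1 : ∀ t, (E.action.act ((E.ofSection e he).fibreCoord p h)
      (liftOpen (p ≫ E.ρ) U h ≫ e) ≫ E.ρ) t ∈ V := by
    rw [key]
    exact h'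
  have h2 : τ.fibreCoord p h' = τ.fibreCoord _ h1 := by
    congr 1
    exact key.symm
  rw [h2, τ.fibreCoord_act _ _ (E.act_ρ _ _) h'']
  ring

lemma fibreCoord_zeroSection (τ : GaTrivialization E.ρ E.action U) (u : T ⟶ U)
    (h : ∀ t, ((u ≫ τ.zeroSection) ≫ E.ρ) t ∈ U) : τ.fibreCoord (u ≫ τ.zeroSection) h = 0 := by
  have e : u ≫ τ.zeroSection = (u ≫ timesGa.mk (𝟙 _) 0) ≫ τ.hom := (Category.assoc _ _ _).symm
  have h' : ∀ t, (((u ≫ timesGa.mk (𝟙 _) 0) ≫ τ.hom) ≫ E.ρ) t ∈ U := by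
    rw [← e]
    exact h
  have : τ.fibreCoord (u ≫ τ.zeroSection) h = τ.fibreCoord _ h' := by
    congr 1
  rw [this]
  refine (τ.coord_hom _ _ _).trans ?_
  rw [timesGa.coord_comp, timesGa.coord_mk, map_zero]

/-- The restriction of a trivialization to a smaller open subset. -/
def restrictTrivialization (τ : GaTrivialization E.ρ E.action U) (k : V ≤ U) :
    GaTrivialization E.ρ E.action V :=
  E.ofSection (S.homOfLE k ≫ τ.zeroSection) (by
    rw [Category.assoc, τ.zeroSection_ρ, Scheme.homOfLE_ι])

lemma fibreCoord_restrictTrivialization (τ : GaTrivialization E.ρ E.action U) (k : V ≤ U)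
    (p : T ⟶ E.X) (h : ∀ t, (p ≫ E.ρ) t ∈ V) :
    (restrictTrivialization τ k).fibreCoord p h = τ.fibreCoord p fun t => k (h t) := by
  have h1 : (liftOpen (p ≫ E.ρ) V h ≫ S.homOfLE k ≫ τ.zeroSection) ≫ E.ρ = p ≫ E.ρ := by
    rw [Category.assoc, Category.assoc, τ.zeroSection_ρ, Scheme.homOfLE_ι, liftOpen_ι]
  have h2 : ∀ t, ((liftOpen (p ≫ E.ρ) V h ≫ S.homOfLE k ≫ τ.zeroSection) ≫ E.ρ) t ∈ U := by
    rw [h1]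
    exact fun t => k (h t)
  rw [restrictTrivialization, fibreCoord_ofSection _ _ τ p h (fun t => k (h t)) h2]
  have h3 : ∀ t, (((liftOpen (p ≫ E.ρ) V h ≫ S.homOfLE k) ≫ τ.zeroSection) ≫ E.ρ) t ∈ U := by
    rw [Category.assoc]
    exact h2
  have h4 : τ.fibreCoord _ h2 = τ.fibreCoord _ h3 := by
    congr 1
  rw [h4, fibreCoord_zeroSection, sub_zero]

/-- A section can be prescribed by its fibre coordinates for a family of trivializations. -/
lemma exists_section {J : Type} {W : J → S.Opens} (hW : ∀ s, ∃ x, s ∈ W x)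
    (τ : ∀ x, GaTrivialization E.ρ E.action (W x)) (U : S.Opens) (c : ∀ x, Γ(S, W x ⊓ U))
    (compat : ∀ (x y : J) {T : Scheme.{0}} (q : T ⟶ S) (hx : ∀ t, q t ∈ W x ⊓ U)
      (hy : ∀ t, q t ∈ W y ⊓ U), evalAt q _ hx (c x) - evalAt q _ hy (c y) =
        evalAt q _ (forall_mem_inf (fun t => (hx t).1) fun t => (hy t).1) (transition (τ x) (τ y))) :
    ∃ (e : U.toScheme ⟶ E.X), e ≫ E.ρ = U.ι ∧
      ∀ (x : J) {T : Scheme.{0}} (u : T ⟶ U) (h : ∀ t, ((u ≫ e) ≫ E.ρ) t ∈ W x)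
        (h' : ∀ t, (u ≫ U.ι) t ∈ W x ⊓ U),
        (τ x).fibreCoord (u ≫ e) h = evalAt (u ≫ U.ι) _ h' (c x) := by
  obtain ⟨e, he⟩ := exists_glue_over (X := E.X) U.ι hW
    (fun x Z a h => (τ x).point (a ≫ U.ι) h (evalAt (a ≫ U.ι) (W x ⊓ U)
      (forall_mem_inf h (comp_ι_mem a)) (c x)))
    (fun x Z Z' b a h h' => by
      have h1 : ∀ t, (b ≫ a ≫ U.ι) t ∈ W x := by simpa using h'
      rw [(τ x).comp_point b _ _ h1, ← evalAt_comp b (a ≫ U.ι) _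
        (forall_mem_inf h1 (by simpa using comp_ι_mem (b ≫ a)))]
      congr 1)
    (fun x y Z a h h' => by
      have h1 : ∀ {x c} (h : ∀ t, (a ≫ U.ι) t ∈ W x) {y},
          (∀ t, (a ≫ U.ι) t ∈ W y) → ∀ t, ((τ x).point (a ≫ U.ι) h c ≫ E.ρ) t ∈ W y := by
        intro x c h y h'
        rw [(τ x).point_ρ]
        exact h'
      refine (τ x).eq_of_fibreCoord_eq (by rw [(τ x).point_ρ, (τ y).point_ρ]) (h1 h h) (h1 h' h) ?_
      rw [(τ x).fibreCoord_point]
      have h2 := evalAt_transition (τ x) (τ y) ((τ y).point (a ≫ U.ι) h'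
        (evalAt (a ≫ U.ι) (W y ⊓ U) (forall_mem_inf h' (comp_ι_mem a)) (c y)))
        (forall_mem_inf (h1 h' h) (h1 h' h'))
      rw [(τ y).fibreCoord_point] at h2
      have h3 := compat x y (a ≫ U.ι) (forall_mem_inf h (comp_ι_mem a))
        (forall_mem_inf h' (comp_ι_mem a))
      rw [evalAt_congr ((τ y).point_ρ _ _ _)] at h2
      linear_combination h3 + h2)
  have heρ : e ≫ E.ρ = U.ι := hom_ext_over U.ι hW fun x Z a h => by
    rw [← Category.assoc, he x a h, (τ x).point_ρ]
  refine ⟨e, heρ, fun x T u h h' => ?_⟩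
  have h1 : ∀ t, (u ≫ U.ι) t ∈ W x := fun t => (h' t).1
  have h2 := he x u h1
  have h3 : ∀ t, ((τ x).point (u ≫ U.ι) h1 (evalAt (u ≫ U.ι) _ h' (c x)) ≫ E.ρ) t ∈ W x := by
    rw [(τ x).point_ρ]
    exact h1
  rw [← (τ x).fibreCoord_point (u ≫ U.ι) h1 (evalAt (u ≫ U.ι) _ h' (c x)) h3]
  congr 1

/-- If a cocycle on a covering `U` becomes cohomologous, after refinement, to the cocycle of a
bundle, then it is the cocycle of the bundle for some trivializations over `U`. -/
lemma exists_trivializations {J I : Type} {W : J → S.Opens} (hW : ∀ s, ∃ x, s ∈ W x)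
    (τ : ∀ x, GaTrivialization E.ρ E.action (W x)) {U : I → S.Opens} {k : J → I}
    (hk : ∀ x, W x ≤ U (k x)) (g : ∀ i j, Γ(S, U i ⊓ U j)) (s : ∀ x, Γ(S, W x))
    (hg : ∀ (i j l : I) {T : Scheme.{0}} (q : T ⟶ S) (hi : ∀ t, q t ∈ U i) (hj : ∀ t, q t ∈ U j)
      (hl : ∀ t, q t ∈ U l), evalAt q (U i ⊓ U j) (forall_mem_inf hi hj) (g i j) +
        evalAt q (U j ⊓ U l) (forall_mem_inf hj hl) (g j l) =
        evalAt q (U i ⊓ U l) (forall_mem_inf hi hl) (g i l))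
    (hs : ∀ (x y : J) {T : Scheme.{0}} (q : T ⟶ S) (hx : ∀ t, q t ∈ W x) (hy : ∀ t, q t ∈ W y),
      evalAt q (W x ⊓ W y) (forall_mem_inf hx hy) (transition (τ x) (τ y)) -
        evalAt q (U (k x) ⊓ U (k y)) (forall_mem_inf (fun t => hk x (hx t)) fun t => hk y (hy t)) (g (k x) (k y)) =
        evalAt q (W y) hy (s y) - evalAt q (W x) hx (s x)) :
    ∃ τ' : ∀ i, GaTrivialization E.ρ E.action (U i), ∀ i j, transition (τ' i) (τ' j) = g i j := by
  -- By `hs`, the shifted coordinates `t_x + s_x` differ from one another by `g (k x) (k y)`, so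
  -- they should be the coordinates of the desired trivialization over `U (k x)`. The zero section
  -- of the one over `U i` must then satisfy `t_x + s_x = g (k x) i`, which gives `c i x`.
  let c : ∀ i x, Γ(S, W x ⊓ U i) := fun i x =>
    S.presheaf.map (homOfLE (inf_le_inf_right (U i) (hk x))).op (g (k x) i) -
      S.presheaf.map (homOfLE (inf_le_left : W x ⊓ U i ≤ W x)).op (s x)
  have hc : ∀ i x {T : Scheme.{0}} (q : T ⟶ S) (h : ∀ t, q t ∈ W x ⊓ U i),
      evalAt q _ h (c i x) =
        evalAt q (U (k x) ⊓ U i) (forall_mem_inf (fun t => hk x (h t).1) fun t => (h t).2) (g (k x) i) -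
          evalAt q (W x) (fun t => (h t).1) (s x) := by
    intro i x T q h
    rw [map_sub, evalAt_map q _ h fun t => (h t).1,
      evalAt_map q _ h (forall_mem_inf (fun t => hk x (h t).1) fun t => (h t).2)]
  have ex := fun i => exists_section hW τ (U i) (c i) fun x y T q hx hy => by
    rw [hc, hc]
    have h1 := hg (k x) (k y) i q (fun t => hk x (hx t).1) (fun t => hk y (hy t).1)
      fun t => (hx t).2
    have h2 := hs x y q (fun t => (hx t).1) (fun t => (hy t).1)
    linear_combination -h1 - h2
  choose e he hec using ex
  refine ⟨fun i => E.ofSection (e i) (he i), fun i j => transition_eq _ _ fun {T} p h => ?_⟩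
  -- Over `W x` the new coordinates are `t_x + s_x - g (k x) i`, by `key` below. In the difference
  -- for `i` and `j` the terms `t_x` and `s_x` cancel, and the cocycle relation for `k x, i, j`
  -- leaves `g i j`.
  refine section_ext_over (p ≫ E.ρ) hW fun x Z a ha => ?_
  have h1 : (a ≫ p) ≫ E.ρ = a ≫ p ≫ E.ρ := Category.assoc _ _ _
  have hx : ∀ z, ((a ≫ p) ≫ E.ρ) z ∈ W x := by
    rw [h1]
    exact ha
  have hi : ∀ z, ((a ≫ p) ≫ E.ρ) z ∈ U i := fun z => by
    rw [h1]
    exact (forall_comp_mem a h z).1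
  have hj : ∀ z, ((a ≫ p) ≫ E.ρ) z ∈ U j := fun z => by
    rw [h1]
    exact (forall_comp_mem a h z).2
  have hl : ∀ i (hi : ∀ z, ((a ≫ p) ≫ E.ρ) z ∈ U i),
      (liftOpen ((a ≫ p) ≫ E.ρ) (U i) hi ≫ e i) ≫ E.ρ = (a ≫ p) ≫ E.ρ := fun i hi => by
    rw [Category.assoc, he, liftOpen_ι]
  have hl' : ∀ i (hi : ∀ z, ((a ≫ p) ≫ E.ρ) z ∈ U i),
      ∀ z, ((liftOpen ((a ≫ p) ≫ E.ρ) (U i) hi ≫ e i) ≫ E.ρ) z ∈ W x := fun i hi => by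
    rw [hl]
    exact hx
  have hl'' : ∀ i (hi : ∀ z, ((a ≫ p) ≫ E.ρ) z ∈ U i),
      ∀ z, (liftOpen ((a ≫ p) ≫ E.ρ) (U i) hi ≫ (U i).ι) z ∈ W x ⊓ U i := fun i hi => by
    rw [liftOpen_ι]
    exact forall_mem_inf hx hi
  have key : ∀ i (hi : ∀ z, ((a ≫ p) ≫ E.ρ) z ∈ U i),
      (E.ofSection (e i) (he i)).fibreCoord (a ≫ p) hi = (τ x).fibreCoord (a ≫ p) hx -
        (evalAt ((a ≫ p) ≫ E.ρ) (U (k x) ⊓ U i) (forall_mem_inf (fun t => hk x (hx t)) hi) (g (k x) i) -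
          evalAt ((a ≫ p) ≫ E.ρ) (W x) hx (s x)) := fun i hi => by
    rw [fibreCoord_ofSection _ _ (τ x) _ hi hx (hl' i hi), hec i x _ _ (hl'' i hi), ← hc i x _
      (forall_mem_inf hx hi)]
    rw [evalAt_congr (liftOpen_ι _ _ _)]
  rw [map_sub, ← GaTrivialization.fibreCoord_comp _ _ _ _ hi,
    ← GaTrivialization.fibreCoord_comp _ _ _ _ hj, key, key, ← evalAt_comp a (p ≫ E.ρ) h
      (forall_comp_mem a h)]
  have h2 := hg (k x) i j _ (fun z => hk x (hx z)) hi hj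
  rw [evalAt_congr h1.symm]
  linear_combination -h2

end GaBundle

/-! ### Equality of Čech classes -/

section CechClass

variable {X Y : TopCat.{0}} (F : TopCat.Presheaf AddCommGrpCat.{0} X)

/-- The restriction of cocycles to a finer covering. -/
def cechZ1Refine {U V : PointedCover X} (h : U ≤ V) : cechZ1 F U →+ cechZ1 F V :=
  cechZ1Map (𝟙 X) (F := F) (G := F) (V := U) (U := V) { app := fun _ => 𝟙 _ } h

lemma resHom_refl {U : Opens X} (s : F.obj (op U)) : resHom F (le_refl U) s = s := by
  have : F.map (homOfLE (le_refl U)).op = 𝟙 _ := F.map_id (op U)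
  rw [resHom, this]
  rfl

/-- Functoriality of refinement is what `AddCommGroup.DirectLimit.of.zero_exact` needs: a class that
vanishes in the limit already vanishes on some finer covering. -/
instance : DirectedSystem (CechH1Cover F) fun U V h => cechH1Refine F U V h where
  map_self U c := by
    obtain ⟨g, rfl⟩ := QuotientAddGroup.mk_surjective c
    refine congrArg QuotientAddGroup.mk (Subtype.ext ?_)
    funext x y
    exact resHom_refl F _
  map_map U V W h k c := by
    obtain ⟨g, rfl⟩ := QuotientAddGroup.mk_surjective c
    refine congrArg QuotientAddGroup.mk (Subtype.ext ?_)
    funext x y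
    exact resHom_resHom F _ _ _

lemma cechClass_refine {U V : PointedCover X} (h : U ≤ V) (g : cechZ1 F U) :
    cechClass F V (cechZ1Refine F h g) = cechClass F U g := by
  classical
  exact AddCommGroup.DirectLimit.of_f (G := CechH1Cover F) (f := cechH1Refine F) h
    (QuotientAddGroup.mk g)

lemma exists_cechClass (c : CechH1 F) : ∃ U g, cechClass F U g = c := by
  classical
  induction c using AddCommGroup.DirectLimit.induction_on with
  | ih U c =>
    obtain ⟨g, rfl⟩ := QuotientAddGroup.mk_surjective c
    exact ⟨U, g, rfl⟩

lemma cechClass_eq_of {U V W : PointedCover X} (hU : U ≤ W) (hV : V ≤ W) (g : cechZ1 F U)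
    (g' : cechZ1 F V) (s : ∀ x, F.obj (op (W.nhd x)))
    (hs : ∀ x y, resHom F (inf_le_inf (hU x) (hU y)) (g.1 x y) -
      resHom F (inf_le_inf (hV x) (hV y)) (g'.1 x y) =
        resHom F inf_le_right (s y) - resHom F inf_le_left (s x)) :
    cechClass F U g = cechClass F V g' := by
  classical
  rw [← cechClass_refine F hU, ← cechClass_refine F hV]
  refine congrArg (AddCommGroup.DirectLimit.of (CechH1Cover F) (cechH1Refine F) W) ?_
  rw [← sub_eq_zero, ← QuotientAddGroup.mk_sub, QuotientAddGroup.eq_zero_iff]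
  refine ⟨s, ?_⟩
  funext x y
  exact (hs x y).symm

/-- On a common refinement the difference of the two cocycles is defined. Its class vanishes in the
direct limit, hence on some still finer covering, where the difference is a coboundary. -/
lemma exists_of_cechClass_eq {U V : PointedCover X} (g : cechZ1 F U) (g' : cechZ1 F V)
    (h : cechClass F U g = cechClass F V g') :
    ∃ (W : PointedCover X) (hU : U ≤ W) (hV : V ≤ W) (s : ∀ x, F.obj (op (W.nhd x))),
      ∀ x y, resHom F (inf_le_inf (hU x) (hU y)) (g.1 x y) -
        resHom F (inf_le_inf (hV x) (hV y)) (g'.1 x y) =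
          resHom F inf_le_right (s y) - resHom F inf_le_left (s x) := by
  classical
  obtain ⟨W, hU, hV⟩ := exists_ge_ge U V
  rw [← cechClass_refine F hU, ← cechClass_refine F hV, ← sub_eq_zero] at h
  have h' : AddCommGroup.DirectLimit.of (CechH1Cover F) (cechH1Refine F) W
      (QuotientAddGroup.mk (cechZ1Refine F hU g - cechZ1Refine F hV g')) = 0 := by
    rw [QuotientAddGroup.mk_sub, map_sub]
    exact h
  obtain ⟨W', hW, h0⟩ := AddCommGroup.DirectLimit.of.zero_exact _ _ h'
  have h1 : (QuotientAddGroup.mk (cechZ1Refine F hW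
      (cechZ1Refine F hU g - cechZ1Refine F hV g')) : CechH1Cover F W') = 0 := h0
  rw [QuotientAddGroup.eq_zero_iff] at h1
  obtain ⟨s, hs⟩ := h1
  refine ⟨W', hU.trans hW, hV.trans hW, s, fun x y => ?_⟩
  have h2 := congrFun (congrFun hs x) y
  refine Eq.trans ?_ h2.symm
  rw [map_sub]
  exact congrArg₂ (fun a b => a - b) (resHom_resHom F _ _ _).symm (resHom_resHom F _ _ _).symm

lemma cechH1Map_cechClass (f : X ⟶ Y) {G : TopCat.Presheaf AddCommGrpCat.{0} Y}
    (φ : G ⟶ (TopCat.Presheaf.pushforward _ f).obj F) (V : PointedCover Y) (g : cechZ1 G V) :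
    cechH1Map f φ (cechClass G V g) =
      cechClass F (V.comap f) (cechZ1Map f φ (U := V.comap f) (fun _ => le_refl _) g) := by
  classical
  exact AddCommGroup.DirectLimit.lift_of (G := CechH1Cover G) (f := cechH1Refine G) _ _ _ V
    (QuotientAddGroup.mk g)

end CechClass

/-! ### The class of a `𝔾ₐ`-bundle -/

namespace GaBundle

variable {S : Scheme.{0}} {E E' : GaBundle S}

lemma evalAt_resHom {T : Scheme.{0}} (q : T ⟶ S) {U V : S.Opens} (k : V ≤ U)
    (h : ∀ t, q t ∈ V) (s : Γ(S, U)) :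
    evalAt q V h (resHom (addStructureSheaf S) k s : Γ(S, V)) =
      evalAt q U (fun t => k (h t)) s :=
  evalAt_map q (homOfLE k) h _ s

/-- The class of a bundle can be computed by any family of trivializations. -/
lemma cohomologyClass_eq (𝒰 : PointedCover S.carrier)
    (τ : ∀ s : S, GaTrivialization E.ρ E.action (𝒰.nhd s)) :
    E.cohomologyClass = cechClass _ 𝒰 (E.cocycle 𝒰 τ) := by
  obtain ⟨W, h1, h2⟩ := exists_ge_ge E.cover 𝒰
  have hW : ∀ x, W.nhd x ≤ 𝒰.nhd x ⊓ E.cover.nhd x := fun x => le_inf (h2 x) (h1 x)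
  -- The cochain compares, at each `x`, the given trivialization with the one chosen in
  -- `E.trivialization`. At a point of the bundle both sides become the same combination of four
  -- fibre coordinates.
  refine cechClass_eq_of _ h1 h2 _ _ (fun x => resHom (addStructureSheaf S) (hW x)
    (transition (τ x) (E.trivialization x))) fun x y => ?_
  refine ext_evalAt (S := S) (U := W.nhd x ⊓ W.nhd y) fun {T} q hq => ?_
  obtain ⟨p, rfl⟩ : ∃ p, q = p ≫ E.ρ := ⟨(τ x).point q (fun t => h2 x (hq t).1) 0, by simp⟩
  refine (map_sub (evalAt (p ≫ E.ρ) _ hq) _ _).trans (Eq.trans ?_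
    (map_sub (evalAt (p ≫ E.ρ) _ hq) _ _).symm)
  have hxy : ∀ {U V : S.Opens} (k : W.nhd x ⊓ W.nhd y ≤ U ⊓ V)
      (τ₁ : GaTrivialization E.ρ E.action U) (τ₂ : GaTrivialization E.ρ E.action V),
      evalAt (p ≫ E.ρ) (W.nhd x ⊓ W.nhd y) hq
        (resHom (addStructureSheaf S) k (transition τ₁ τ₂) : Γ(S, W.nhd x ⊓ W.nhd y)) =
        τ₁.fibreCoord p (fun t => (k (hq t)).1) - τ₂.fibreCoord p (fun t => (k (hq t)).2) :=
    fun k τ₁ τ₂ => (evalAt_resHom _ _ _ _).trans (evalAt_transition τ₁ τ₂ p fun t => k (hq t))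
  refine (congrArg₂ (fun a b : Γ(T, ⊤) => a - b) (hxy _ _ _) (hxy _ _ _)).trans (Eq.trans ?_
    (congrArg₂ (fun a b : Γ(T, ⊤) => a - b)
      ((congrArg (evalAt (p ≫ E.ρ) _ hq) (resHom_resHom _ _ _ _)).trans
        (hxy (inf_le_right.trans (hW y)) (τ y) (E.trivialization y)))
      ((congrArg (evalAt (p ≫ E.ρ) _ hq) (resHom_resHom _ _ _ _)).trans
        (hxy (inf_le_left.trans (hW x)) (τ x) (E.trivialization x)))).symm)
  ring

/-- Transport of a trivialization by an isomorphism of bundles. -/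
def Iso.transport (f : E.Iso E') {U : S.Opens} (τ : GaTrivialization E.ρ E.action U) :
    GaTrivialization E'.ρ E'.action U where
  hom := τ.hom ≫ f.iso.hom
  isPullback := by
    have h : IsPullback f.iso.hom E.ρ E'.ρ (𝟙 S) :=
      IsPullback.of_horiz_isIso ⟨by rw [f.comp_ρ, Category.comp_id]⟩
    simpa using τ.isPullback.paste_horiz h
  equivariant {T} a p := by
    rw [← Category.assoc, τ.equivariant, f.equivariant, Category.assoc]

lemma Iso.fibreCoord_transport (f : E.Iso E') {U : S.Opens} (τ : GaTrivialization E.ρ E.action U)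
    {T : Scheme.{0}} (p : T ⟶ E.X) (h : ∀ t, (p ≫ E.ρ) t ∈ U)
    (h' : ∀ t, ((p ≫ f.iso.hom) ≫ E'.ρ) t ∈ U) :
    (f.transport τ).fibreCoord (p ≫ f.iso.hom) h' = τ.fibreCoord p h := by
  obtain ⟨m, rfl⟩ : ∃ m, p = m ≫ τ.hom := ⟨_, (τ.point_fibreCoord p h).symm⟩
  have e1 : (m ≫ τ.hom) ≫ f.iso.hom = m ≫ (f.transport τ).hom := Category.assoc _ _ _
  have h'' : ∀ t, ((m ≫ (f.transport τ).hom) ≫ E'.ρ) t ∈ U := by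
    rw [← e1]
    exact h'
  have e2 : (f.transport τ).fibreCoord _ h' = (f.transport τ).fibreCoord _ h'' := by
    congr 1
  rw [e2]
  exact ((f.transport τ).coord_hom _ _ _).trans (τ.coord_hom _ _ _).symm

/-- Isomorphic bundles have the same class. -/
lemma Iso.cohomologyClass_eq (f : E.Iso E') : E.cohomologyClass = E'.cohomologyClass := by
  rw [GaBundle.cohomologyClass_eq (E := E') E.cover fun s => f.transport (E.trivialization s)]
  refine congrArg (cechClass _ E.cover) (Subtype.ext ?_)
  funext x y
  refine (transition_eq (f.transport (E.trivialization x)) (f.transport (E.trivialization y))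
    fun {T} p h => ?_).symm
  obtain ⟨p, rfl⟩ : ∃ p', p = p' ≫ f.iso.hom := ⟨p ≫ f.iso.inv, by simp⟩
  have e : (p ≫ f.iso.hom) ≫ E'.ρ = p ≫ E.ρ := by rw [Category.assoc, f.comp_ρ]
  have h' : ∀ t, (p ≫ E.ρ) t ∈ E.cover.nhd x ⊓ E.cover.nhd y := by
    rw [← e]
    exact h
  rw [f.fibreCoord_transport _ _ fun t => (h' t).1, f.fibreCoord_transport _ _ fun t => (h' t).2]
  exact (evalAt_transition _ _ p h').symm.trans (evalAt_congr e.symm h' _)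

end GaBundle

/-! ### Lifts of a `𝔾ₘ`-action and homogeneous functions -/

/-- The inverse image of an invertible function. -/
abbrev pullUnit {T T' : Scheme.{0}} (f : T' ⟶ T) : (Γ(T, ⊤))ˣ →* (Γ(T', ⊤))ˣ :=
  Units.map f.appTop.hom

lemma pullUnit_comp {T T' T'' : Scheme.{0}} (g : T'' ⟶ T') (f : T' ⟶ T) (a : (Γ(T, ⊤))ˣ) :
    pullUnit (g ≫ f) a = pullUnit g (pullUnit f a) :=
  Units.ext (congrArg (fun m => m.hom a.val) (Scheme.Hom.comp_appTop g f))

lemma appTop_zpow {T T' : Scheme.{0}} (f : T' ⟶ T) (a : (Γ(T, ⊤))ˣ) (n : ℤ) :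
    f.appTop (a ^ n).val = (pullUnit f a ^ n).val := by
  rw [← map_zpow]
  rfl

/-- A function `h` on `U` is homogeneous of degree `n`: `h(λ · u) = λⁿ h(u)`. -/
def GmAction.IsHomogeneous {S : Scheme.{0}} (σ : GmAction S) (n : ℤ) {U : S.Opens}
    (h : Γ(S, U)) : Prop :=
  ∀ {T : Scheme.{0}} (a : (Γ(T, ⊤))ˣ) (q : T ⟶ S) (hq : ∀ t, q t ∈ U)
    (hq' : ∀ t, σ.act a q t ∈ U), evalAt (σ.act a q) U hq' h = (a ^ n).val * evalAt q U hq h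

lemma GmAction.Stable.act_mem {S : Scheme.{0}} {σ : GmAction S} {U : S.Opens} (hU : σ.Stable U)
    {T : Scheme.{0}} (a : (Γ(T, ⊤))ˣ) {q : T ⟶ S} (hq : ∀ t, q t ∈ U) :
    ∀ t, σ.act a q t ∈ U := fun t => by
  have := hU a (liftOpen q U hq) ⟨t, rfl⟩
  rwa [liftOpen_ι] at this

lemma GmAction.restrict_act_ι {S : Scheme.{0}} (σ : GmAction S) {U : S.Opens} (hU : σ.Stable U)
    {T : Scheme.{0}} (a : (Γ(T, ⊤))ˣ) (u : T ⟶ U) :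
    (σ.restrict hU).act a u ≫ U.ι = σ.act a (u ≫ U.ι) :=
  IsOpenImmersion.lift_fac _ _ _

namespace GaBundle

variable {S : Scheme.{0}} {E : GaBundle S} {σ : GmAction S} {n : ℤ}

/-- The equivariance of a trivialization, in terms of points. -/
lemma act_point {σ' : GmAction E.X} {U : S.Opens} (hU : σ.Stable U)
    (τ : GaTrivialization E.ρ E.action U)
    (hτ : ((σ.restrict hU).prodGa n).Equivariant σ' τ.hom) {T : Scheme.{0}} (a : (Γ(T, ⊤))ˣ)
    (q : T ⟶ S) (hq : ∀ t, q t ∈ U) (c : Γ(T, ⊤)) :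
    σ'.act a (τ.point q hq c) =
      τ.point (σ.act a q) (hU.act_mem a hq) ((a ^ n).val * c) := by
  rw [GaTrivialization.point, GaTrivialization.point, ← hτ]
  congr 1
  refine timesGa.ext ?_ (by simp [GmAction.prodGa])
  rw [← cancel_mono U.ι]
  simp [GmAction.prodGa, GmAction.restrict_act_ι]

/-- If two trivializations are equivariant, then the transition function is homogeneous. -/
lemma isHomogeneous_transition {σ' : GmAction E.X} {U V : S.Opens}
    (hU : σ.Stable U) (hV : σ.Stable V) (τ : GaTrivialization E.ρ E.action U)
    (τ' : GaTrivialization E.ρ E.action V)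
    (hτ : ((σ.restrict hU).prodGa n).Equivariant σ' τ.hom)
    (hτ' : ((σ.restrict hV).prodGa n).Equivariant σ' τ'.hom) :
    σ.IsHomogeneous n (transition τ τ') := by
  intro T a q hq hq'
  obtain ⟨p, hp⟩ : ∃ p, p ≫ E.ρ = q := ⟨τ.point q (fun t => (hq t).1) 0, by simp⟩
  subst hp
  have h1 := act_point hU τ hτ a _ (fun t => (hq t).1) (τ.fibreCoord p fun t => (hq t).1)
  have h2 := act_point hV τ' hτ' a _ (fun t => (hq t).2) (τ'.fibreCoord p fun t => (hq t).2)
  rw [GaTrivialization.point_fibreCoord] at h1 h2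
  have e : σ'.act a p ≫ E.ρ = σ.act a (p ≫ E.ρ) := by rw [h1, τ.point_ρ]
  have h3 : ∀ t, (σ'.act a p ≫ E.ρ) t ∈ U ⊓ V := by
    rw [e]
    exact hq'
  have h4 : τ.fibreCoord (σ'.act a p) (fun t => (h3 t).1) =
      (a ^ n).val * τ.fibreCoord p fun t => (hq t).1 := by
    refine Eq.trans ?_ (τ.fibreCoord_point (σ.act a (p ≫ E.ρ)) (fun t => (hq' t).1) _ ?_)
    · congr 1
    · rw [τ.point_ρ]
      exact fun t => (hq' t).1
  have h5 : τ'.fibreCoord (σ'.act a p) (fun t => (h3 t).2) =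
      (a ^ n).val * τ'.fibreCoord p fun t => (hq t).2 := by
    refine Eq.trans ?_ (τ'.fibreCoord_point (σ.act a (p ≫ E.ρ)) (fun t => (hq' t).2) _ ?_)
    · congr 1
    · rw [τ'.point_ρ]
      exact fun t => (hq' t).2
  rw [← evalAt_congr e h3, evalAt_transition, evalAt_transition, h4, h5, mul_sub]

/-- If the transition functions of a family of trivializations are homogeneous, then the
`𝔾ₘ`-action lifts in such a way that the trivializations are equivariant. -/
lemma exists_lift {I : Type} {U : I → S.Opens} (hcov : ∀ s, ∃ i, s ∈ U i)
    (hU : ∀ i, σ.Stable (U i)) (τ : ∀ i, GaTrivialization E.ρ E.action (U i))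
    (hτ : ∀ i j, σ.IsHomogeneous n (transition (τ i) (τ j))) :
    ∃ σ' : GmAction E.X, σ.IsLift E.ρ σ' ∧
      ∀ i, ((σ.restrict (hU i)).prodGa n).Equivariant σ' (τ i).hom := by
  have hm : ∀ i {T : Scheme.{0}} (a : (Γ(T, ⊤))ˣ) {q : T ⟶ S}, (∀ t, q t ∈ U i) →
      ∀ t, σ.act a q t ∈ U i := fun i T a q h => GmAction.Stable.act_mem (U := U i) (hU i) a h
  -- The equivariance required of `τ i` forces this formula over `U i`. It is recorded for every `b
  -- : Z ⟶ T` landing over `U i`, so that naturality and the axioms of an action follow by local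
  -- comparison.
  have ex : ∀ {T : Scheme.{0}} (a : (Γ(T, ⊤))ˣ) (p : T ⟶ E.X), ∃ F : T ⟶ E.X,
      ∀ (i : I) {Z : Scheme.{0}} (b : Z ⟶ T) (h : ∀ z, (b ≫ p ≫ E.ρ) z ∈ U i),
        b ≫ F = (τ i).point (σ.act (pullUnit b a) ((b ≫ p) ≫ E.ρ))
          (hm i _ (by simpa using h)) (((pullUnit b a) ^ n).val *
            (τ i).fibreCoord (b ≫ p) (by simpa using h)) := by
    intro T a p
    refine exists_glue_over (p ≫ E.ρ) hcov _ ?_ ?_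
    · intro i Z Z' b c h h'
      have e : b ≫ σ.act (pullUnit c a) ((c ≫ p) ≫ E.ρ) =
          σ.act (pullUnit (b ≫ c) a) (((b ≫ c) ≫ p) ≫ E.ρ) := by
        rw [σ.comp_act, pullUnit_comp, Category.assoc, Category.assoc, Category.assoc]
      rw [(τ i).comp_point b _ _ (by
        rw [e]
        exact hm i _ (by simpa using h'))]
      congr 1
      rw [map_mul, ← (τ i).fibreCoord_comp b _ _ (by simpa using h'), appTop_zpow, pullUnit_comp]
      congr 1
    -- On an overlap the two candidates have `τ i`-coordinates differing by `λⁿ h_ij(q) - h_ij(λq)`,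
    -- which is zero by homogeneity.
    · intro i j Z c h h'
      set q := (c ≫ p) ≫ E.ρ with hq
      set a' := pullUnit c a
      have hi : ∀ t, q t ∈ U i := by simpa [hq] using h
      have hj : ∀ t, q t ∈ U j := by simpa [hq] using h'
      have hai := hm i a' hi
      have haj := hm j a' hj
      refine (τ i).eq_of_fibreCoord_eq (by rw [(τ i).point_ρ, (τ j).point_ρ])
        (by rw [(τ i).point_ρ]; exact hai) (by rw [(τ j).point_ρ]; exact hai) ?_
      rw [(τ i).fibreCoord_point]
      have h1 := evalAt_transition (τ i) (τ j) (c ≫ p) (forall_mem_inf hi hj)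
      have h2 := evalAt_transition (τ i) (τ j)
        ((τ j).point (σ.act a' q) haj ((a' ^ n).val * (τ j).fibreCoord (c ≫ p) hj))
        (by rw [(τ j).point_ρ]; exact forall_mem_inf hai haj)
      rw [evalAt_congr ((τ j).point_ρ _ _ _), (τ j).fibreCoord_point] at h2
      have h3 := hτ i j a' q (forall_mem_inf hi hj) (forall_mem_inf hai haj)
      rw [h1, h2] at h3
      linear_combination -h3
  choose act hact using @ex
  have hact' : ∀ {T : Scheme.{0}} (a : (Γ(T, ⊤))ˣ) (p : T ⟶ E.X) (i : I)
      (h : ∀ t, (p ≫ E.ρ) t ∈ U i), act a p = (τ i).point (σ.act a (p ≫ E.ρ))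
        (hm i a h) ((a ^ n).val * (τ i).fibreCoord p h) := by
    intro T a p i h
    have h1 := hact a p i (𝟙 T) (by simpa using h)
    rw [Category.id_comp] at h1
    rw [h1]
    congr 1
  have hcomp : ∀ {T T' : Scheme.{0}} (f : T' ⟶ T) (a : (Γ(T, ⊤))ˣ) (p : T ⟶ E.X),
      f ≫ act a p = act (pullUnit f a) (f ≫ p) := by
    intro T T' f a p
    refine hom_ext_over (f ≫ p ≫ E.ρ) hcov fun i Z b h => ?_
    rw [← Category.assoc, hact a p i (b ≫ f) (by simpa using h),
      hact _ (f ≫ p) i b (by simpa using h)]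
    congr 1
  have hρ : ∀ {T : Scheme.{0}} (a : (Γ(T, ⊤))ˣ) (p : T ⟶ E.X),
      act a p ≫ E.ρ = σ.act a (p ≫ E.ρ) := by
    intro T a p
    refine hom_ext_over (p ≫ E.ρ) hcov fun i Z b h => ?_
    rw [← Category.assoc, hact a p i b h, (τ i).point_ρ, σ.comp_act, Category.assoc]
  refine ⟨{ act := act, one_act := ?_, mul_act := ?_, comp_act := hcomp }, hρ, fun i T a p => ?_⟩
  · intro T p
    refine hom_ext_over (p ≫ E.ρ) hcov fun i Z b h => ?_
    have h' : ∀ t, ((b ≫ p) ≫ E.ρ) t ∈ U i := by simpa using h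
    rw [hcomp, hact' _ _ i h']
    conv_rhs => rw [← (τ i).point_fibreCoord (b ≫ p) h']
    congr 1
    · rw [map_one, σ.one_act]
    · simp
  · intro T a a' p
    refine hom_ext_over (p ≫ E.ρ) hcov fun i Z b h => ?_
    have h' : ∀ t, ((b ≫ p) ≫ E.ρ) t ∈ U i := by simpa using h
    rw [hcomp, hcomp, hcomp]
    set c := pullUnit b a
    set c' := pullUnit b a'
    have h'' : ∀ t, (act c' (b ≫ p) ≫ E.ρ) t ∈ U i := by
      rw [hρ]
      exact hm i _ h'
    rw [hact' _ _ i h', hact' _ _ i h'']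
    congr 1
    · rw [map_mul, σ.mul_act, hρ]
    · have : (τ i).fibreCoord _ h'' = (c' ^ n).val * (τ i).fibreCoord (b ≫ p) h' := by
        refine Eq.trans ?_ ((τ i).fibreCoord_point (σ.act c' ((b ≫ p) ≫ E.ρ))
          (hm i _ h') _ (by simpa using hm i _ h'))
        congr 1
        exact hact' _ _ i h'
      rw [this, map_mul, mul_zpow, Units.val_mul, mul_assoc]
  · have hp : (p ≫ (τ i).hom) ≫ E.ρ = (p ≫ timesGa.fst (U i)) ≫ (U i).ι := by
      rw [Category.assoc, (τ i).isPullback.w, Category.assoc]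
    have h : ∀ t, ((p ≫ (τ i).hom) ≫ E.ρ) t ∈ U i := by
      rw [hp]
      exact comp_ι_mem _
    change _ = act a (p ≫ (τ i).hom)
    rw [hact' _ _ i h, GaTrivialization.point]
    congr 1
    refine timesGa.ext ?_ ?_
    · rw [← cancel_mono (U i).ι]
      simp only [GmAction.prodGa, timesGa.mk_fst, GmAction.restrict_act_ι, liftOpen_ι, hp]
    · simp only [GmAction.prodGa, timesGa.coord_mk]
      congr 1
      exact ((τ i).coord_hom _ _ _).symm

end GaBundle

/-! ### Homogeneous components of polynomials -/

/-- The homogeneous component of degree `k` of a polynomial. -/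
abbrev polyComponent (f : PolyRing) (k : ℕ) : PolyRing := DirectSum.decompose polyGrading f k

lemma polyComponent_mem (f : PolyRing) (k : ℕ) : polyComponent f k ∈ polyGrading k :=
  SetLike.coe_mem (DirectSum.decompose polyGrading f k)

lemma mem_homogeneousCore_iff_component (I : Ideal PolyRing) (f : PolyRing) :
    f ∈ I.homogeneousCore polyGrading ↔ ∀ k, polyComponent f k ∈ I := by
  refine ⟨fun h k => Ideal.toIdeal_homogeneousCore_le polyGrading I
    ((I.homogeneousCore polyGrading).isHomogeneous k h), fun h => ?_⟩
  rw [← DirectSum.sum_support_decompose polyGrading f]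
  exact sum_mem fun k _ => (mem_homogeneousCore_iff I (polyComponent_mem f k)).mpr (h k)

/-- Each monomial of `f` has total degree `k` and contributes `a ^ k`. The scalar is arbitrary
because both units on a scheme and the indeterminate `Polynomial.X` are needed. -/
lemma eval_scale_of_mem {R : Type*} [CommRing R] (φ : PolyRing →+* R) (a : R) {f : PolyRing}
    {k : ℕ} (hf : f ∈ polyGrading k) :
    MvPolynomial.eval₂Hom (φ.comp MvPolynomial.C) (fun i => a * φ (MvPolynomial.X i)) f =
      a ^ k * φ f := by
  have hφ : φ f = MvPolynomial.eval₂Hom (φ.comp MvPolynomial.C)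
      (fun i => φ (MvPolynomial.X i)) f := by
    congr 1
    apply MvPolynomial.ringHom_ext <;> intros <;> simp
  rw [hφ, MvPolynomial.coe_eval₂Hom, MvPolynomial.coe_eval₂Hom, MvPolynomial.eval₂_eq,
    MvPolynomial.eval₂_eq, Finset.mul_sum]
  refine Finset.sum_congr rfl fun d hd => ?_
  have hdeg : ∑ i ∈ d.support, d i = k := by
    have := (MvPolynomial.mem_homogeneousSubmodule k f).mp hf (MvPolynomial.mem_support_iff.mp hd)
    rw [← this, Pi.one_def, ← Finsupp.degree_eq_weight_one]
    rfl
  simp only [mul_pow]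
  rw [Finset.prod_mul_distrib, Finset.prod_pow_eq_pow_sum, hdeg]
  ring

/-- The polynomial `f(X x, X y)` in the variable `X`, for a point `(x, y)`. -/
def scalePoly {K : Type} [CommRing K] (φ : PolyRing →+* K) : PolyRing →+* Polynomial K :=
  MvPolynomial.eval₂Hom ((Polynomial.C.comp φ).comp MvPolynomial.C)
    (fun i => Polynomial.X * (Polynomial.C.comp φ) (MvPolynomial.X i))

lemma scalePoly_of_mem {K : Type} [CommRing K] (φ : PolyRing →+* K) {f : PolyRing} {k : ℕ}
    (hf : f ∈ polyGrading k) :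
    scalePoly φ f = Polynomial.X ^ k * Polynomial.C (φ f) :=
  eval_scale_of_mem (Polynomial.C.comp φ) Polynomial.X hf

/-- The indeterminate separates the degrees: the component of degree `i` contributes only to the
power `X ^ i`. -/
lemma coeff_scalePoly {K : Type} [CommRing K] (φ : PolyRing →+* K) (f : PolyRing) (k : ℕ) :
    (scalePoly φ f).coeff k = φ (polyComponent f k) := by
  conv_lhs => rw [← DirectSum.sum_support_decompose polyGrading f]
  rw [map_sum, Polynomial.finsetSum_coeff]
  have : ∀ i, (scalePoly φ (polyComponent f i)).coeff k =
      if i = k then φ (polyComponent f i) else 0 := fun i => by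
    rw [scalePoly_of_mem φ (polyComponent_mem f i), Polynomial.coeff_X_pow_mul',
      Polynomial.coeff_C]
    split_ifs <;> first | rfl | omega
  simp only [this]
  rw [Finset.sum_ite_eq']
  split_ifs with h
  · rfl
  · rw [DFinsupp.notMem_support_iff] at h
    change _ = φ ((DirectSum.decompose polyGrading f k : polyGrading k) : PolyRing)
    rw [h]
    simp

/-! ### Points of the punctured plane -/

section Points

variable {T : Scheme.{0}}

/-- The values of polynomials at a `T`-point of the punctured plane. -/
abbrev planeHom (q : T ⟶ puncturedPlane) : PolyRing →+* Γ(T, ⊤) := pointHom (q ≫ puncturedOpen.ι)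

lemma planeHom_act (a : (Γ(T, ⊤))ˣ) (q : T ⟶ puncturedPlane) :
    planeHom (scalarAction.act a q) = scaleHom a (planeHom q) := by
  rw [planeHom, scalarAction, IsOpenImmersion.lift_fac, pointHom_pointOf]

lemma planeHom_act_of_mem (a : (Γ(T, ⊤))ˣ) (q : T ⟶ puncturedPlane) {f : PolyRing} {k : ℕ}
    (hf : f ∈ polyGrading k) :
    planeHom (scalarAction.act a q) f = (a : Γ(T, ⊤)) ^ k * planeHom q f := by
  rw [planeHom_act]
  exact eval_scale_of_mem _ _ hf

lemma evalAt_polyFun (q : T ⟶ puncturedPlane) (W : puncturedPlane.Opens) (h : ∀ t, q t ∈ W)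
    (f : PolyRing) : evalAt q W h (polyFun W f) = planeHom q f := by
  rw [polyFun, RingHom.comp_apply]
  refine (evalAt_map q (homOfLE le_top) h (fun _ => trivial) _).trans ?_
  rw [evalAt_top, planeHom, pointHom_comp]
  rfl

/-- The prime ideal of a point of the punctured plane. -/
abbrev planeIdeal (p : puncturedPlane) : Ideal PolyRing :=
  (puncturedOpen.ι p : PrimeSpectrum PolyRing).asIdeal

instance (p : puncturedPlane) : (planeIdeal p).IsPrime :=
  (puncturedOpen.ι p : PrimeSpectrum PolyRing).isPrime

lemma planeIdeal_injective {p p' : puncturedPlane} (h : planeIdeal p = planeIdeal p') : p = p' :=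
  Subtype.ext (PrimeSpectrum.ext h)

lemma mem_pointIdeal_iff (g : T ⟶ affinePlane) (t : T) (f : PolyRing) :
    f ∈ (g t : PrimeSpectrum PolyRing).asIdeal ↔ t ∉ T.basicOpen (pointHom g f) := by
  rw [← preimage_basicOpen]
  exact not_not.symm

lemma mem_planeIdeal_iff (q : T ⟶ puncturedPlane) (t : T) (f : PolyRing) :
    f ∈ planeIdeal (q t) ↔ t ∉ T.basicOpen (planeHom q f) :=
  mem_pointIdeal_iff (q ≫ puncturedOpen.ι) t f

lemma quotientPoint_eq_iff {p p' : puncturedPlane} :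
    quotientPoint p = quotientPoint p' ↔
      ∀ k, ∀ f ∈ polyGrading k, f ∈ planeIdeal p ↔ f ∈ planeIdeal p' := by
  constructor
  · intro h k f hf
    rw [← mem_homogeneousCore_iff _ hf, ← mem_homogeneousCore_iff _ hf]
    have := congrArg ProjectiveSpectrum.asHomogeneousIdeal h
    exact (congrArg (fun J => f ∈ J) this).to_iff
  · intro h
    refine ProjectiveSpectrum.ext (HomogeneousIdeal.ext (Ideal.ext fun f => ?_))
    change f ∈ (planeIdeal p).homogeneousCore polyGrading ↔
      f ∈ (planeIdeal p').homogeneousCore polyGrading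
    rw [mem_homogeneousCore_iff_component, mem_homogeneousCore_iff_component]
    exact forall_congr' fun k => h k _ (polyComponent_mem f k)

/-- Scaling multiplies the value of a homogeneous polynomial by a power of a unit, so the same
homogeneous polynomials vanish before and after; these determine the image in `ℙ¹`. -/
lemma quotientPoint_act (a : (Γ(T, ⊤))ˣ) (q : T ⟶ puncturedPlane) (t : T) :
    quotientPoint (scalarAction.act a q t) = quotientPoint (q t) := by
  refine quotientPoint_eq_iff.mpr fun k f hf => ?_
  rw [mem_planeIdeal_iff, mem_planeIdeal_iff, planeHom_act_of_mem a q hf, Scheme.basicOpen_mul,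
    Scheme.basicOpen_of_isUnit _ (a.isUnit.pow k), top_inf_eq]

/-- Cones are stable. -/
lemma stable_cone (V : projLine.Opens) : scalarAction.Stable (cone V) := by
  rintro T a u _ ⟨t, rfl⟩
  change quotientPoint _ ∈ V
  rw [quotientPoint_act]
  exact (u t).2

lemma isUnit_of_basicOpen_eq_top {f : Γ(T, ⊤)} (h : T.basicOpen f = ⊤) : IsUnit f := by
  have key : ∀ (W : T.Opens) (k : W ⟶ ⊤), W = ⊤ → IsUnit (T.presheaf.map k.op f) → IsUnit f := by
    rintro W k rfl hf
    have : k = 𝟙 _ := Subsingleton.elim _ _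
    subst this
    have e : T.presheaf.map (𝟙 (⊤ : T.Opens)).op f = f :=
      congrArg (fun m => m.hom f) (T.presheaf.map_id (op ⊤))
    rwa [e] at hf
  exact key _ _ h (RingedSpace.isUnit_res_basicOpen _ f)

/-- Used to cancel denominators: a homogeneous `b` belongs to the prime of a point exactly when it
belongs to its homogeneous core, so it vanishes nowhere on the cone over `W`. -/
lemma isUnit_planeHom {W : projLine.Opens} {b : PolyRing} {j : ℕ} (hb : b ∈ polyGrading j)
    (hW : W ≤ Proj.basicOpen polyGrading b) (q : T ⟶ puncturedPlane) (h : ∀ t, q t ∈ cone W) :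
    IsUnit (planeHom q b) := by
  refine isUnit_of_basicOpen_eq_top (top_le_iff.mp fun t _ => ?_)
  by_contra ht
  rw [← mem_planeIdeal_iff, ← mem_homogeneousCore_iff _ hb] at ht
  exact hW (h t) ht

lemma mem_cone_basicOpen {b : PolyRing} {j : ℕ} (hb : b ∈ polyGrading j) (p : puncturedPlane) :
    p ∈ cone (Proj.basicOpen polyGrading b) ↔ b ∉ planeIdeal p :=
  not_congr (mem_homogeneousCore_iff _ hb)

end Points

/-! ### Stable open subsets of the punctured plane -/

/-- A polynomial without constant term lies in the ideal generated by the two coordinates, so a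
prime containing both would contain the irrelevant ideal. -/
lemma exists_X_notMem (v : projLine) :
    ∃ i : Fin 2, (MvPolynomial.X i : PolyRing) ∉
      (v : ProjectiveSpectrum polyGrading).asHomogeneousIdeal := by
  by_contra! H
  refine (v : ProjectiveSpectrum polyGrading).not_irrelevant_le fun f hf => ?_
  rw [HomogeneousIdeal.mem_irrelevant_iff, GradedRing.proj_apply] at hf
  have hle : Ideal.span (MvPolynomial.X '' (Set.univ : Set (Fin 2))) ≤
      (v : ProjectiveSpectrum polyGrading).asHomogeneousIdeal.toIdeal := by
    rw [Ideal.span_le]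
    rintro _ ⟨i, -, rfl⟩
    exact H i
  refine hle (MvPolynomial.mem_ideal_span_X_image.mpr fun m hm => ?_)
  by_contra! h0
  have hm0 : m = 0 := Finsupp.ext fun i => h0 i trivial
  subst hm0
  have h1 : (DirectSum.decompose polyGrading f 0 : PolyRing) =
      MvPolynomial.homogeneousComponent 0 f :=
    MvPolynomial.decomposition.decompose'_apply f 0
  rw [h1, MvPolynomial.homogeneousComponent_zero] at hf
  exact MvPolynomial.mem_support_iff.mp hm (MvPolynomial.C_injective _ _ (hf.trans (map_zero _).symm))

/-- The generic point of the line over a point of `ℙ¹`. -/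
def conePoint (v : projLine) : puncturedPlane :=
  ⟨⟨(v : ProjectiveSpectrum polyGrading).asHomogeneousIdeal.toIdeal,
    (v : ProjectiveSpectrum polyGrading).isPrime⟩, by
    obtain ⟨i, hi⟩ := exists_X_notMem v
    fin_cases i
    · exact Or.inl hi
    · exact Or.inr hi⟩

/-- A homogeneous ideal is its own homogeneous core. With `continuous_conePoint`, this makes
`conePoint` a continuous section of the quotient map. -/
lemma quotientPoint_conePoint (v : projLine) : quotientPoint (conePoint v) = v :=
  ProjectiveSpectrum.ext (HomogeneousIdeal.toIdeal_homogeneousCore_eq_self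
    (v : ProjectiveSpectrum polyGrading).asHomogeneousIdeal)

lemma continuous_conePoint : Continuous conePoint := by
  refine Continuous.subtype_mk (?_ : Continuous fun v : projLine =>
    (⟨(v : ProjectiveSpectrum polyGrading).asHomogeneousIdeal.toIdeal,
    (v : ProjectiveSpectrum polyGrading).isPrime⟩ : PrimeSpectrum PolyRing)) _
  refine PrimeSpectrum.isTopologicalBasis_basic_opens.continuous_iff.mpr ?_
  rintro _ ⟨f, rfl⟩
  exact (ProjectiveSpectrum.basicOpen polyGrading f).2

/-- A field-valued point over a given point of the plane, together with an invertible function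
which is algebraically independent from the coordinates. -/
lemma exists_generic_point (p : puncturedPlane) :
    ∃ (T : Scheme.{0}) (K : Type) (_ : Field K) (φ : PolyRing →+* K)
      (j : Polynomial K →+* Γ(T, ⊤)) (q : T ⟶ puncturedPlane) (a : (Γ(T, ⊤))ˣ),
      Function.Injective j ∧ (a : Γ(T, ⊤)) = j Polynomial.X ∧
      planeHom q = (j.comp Polynomial.C).comp φ ∧ RingHom.ker φ = planeIdeal p ∧
      (∀ f : Γ(T, ⊤), f ≠ 0 → IsUnit f) ∧ Nonempty T ∧ ∀ t, q t = p := by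
  -- `T` is the spectrum of `K(X)`, a one-point scheme mapped to `p` through the residue field `K`;
  -- the unit is `X`.
  let K := (planeIdeal p).ResidueField
  let φ : PolyRing →+* K := algebraMap PolyRing K
  have hφ : RingHom.ker φ = planeIdeal p := Ideal.ker_algebraMap_residueField _
  let L := FractionRing (Polynomial K)
  let T : Scheme.{0} := Spec (.of L)
  let e : L ≃+* Γ(T, ⊤) := (Scheme.ΓSpecIso (.of L)).symm.commRingCatIsoToRingEquiv
  let j : Polynomial K →+* Γ(T, ⊤) := (e : L →+* Γ(T, ⊤)).comp (algebraMap (Polynomial K) L)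
  have hj : Function.Injective j := e.injective.comp (IsFractionRing.injective (Polynomial K) L)
  have hunit : ∀ f : Γ(T, ⊤), f ≠ 0 → IsUnit f := fun f hf => by
    have : IsUnit (e.symm f) := isUnit_iff_ne_zero.mpr (by simpa using hf)
    simpa using this.map e
  obtain ⟨a, ha⟩ := hunit (j Polynomial.X) fun h =>
    Polynomial.X_ne_zero (hj (h.trans (map_zero j).symm))
  let g : T ⟶ affinePlane := pointOf ((j.comp Polynomial.C).comp φ)
  have hg : ∀ t : T, g t = puncturedOpen.ι p := fun t => by
    refine PrimeSpectrum.ext (Ideal.ext fun f => ?_)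
    rw [mem_pointIdeal_iff, pointHom_pointOf]
    change _ ↔ f ∈ planeIdeal p
    have hfP : f ∈ planeIdeal p ↔ φ f = 0 := (congrArg (fun J => f ∈ J) hφ.symm).to_iff
    rw [hfP]
    constructor
    · intro h
      by_contra hf
      refine h ?_
      rw [Scheme.basicOpen_of_isUnit _ (hunit _ fun h0 => hf ?_)]
      · trivial
      · exact Polynomial.C_injective ((hj (h0.trans (map_zero j).symm)).trans (map_zero _).symm)
    · intro h
      have : ((j.comp Polynomial.C).comp φ) f = 0 := by
        rw [RingHom.comp_apply, h, map_zero]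
      rw [this, Scheme.basicOpen_zero]
      exact fun h => h
  have hr : ∀ t, g t ∈ puncturedOpen := fun t => by
    rw [hg]
    exact p.2
  let t : T := (⊥ : PrimeSpectrum L)
  refine ⟨T, K, inferInstance, φ, j, liftOpen g puncturedOpen hr, a, hj, ha, ?_, hφ, hunit, ⟨t⟩,
    fun t => ?_⟩
  · rw [planeHom, liftOpen_ι, pointHom_pointOf]
  · refine planeIdeal_injective ?_
    have h1 : puncturedOpen.ι (liftOpen g puncturedOpen hr t) = g t :=
      congrArg (fun m : T ⟶ affinePlane => m t) (liftOpen_ι g puncturedOpen hr)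
    rw [planeIdeal, h1, hg]

/-- Scaling by the generic unit `X` turns the value of `f` into the polynomial `f(X x, X y)`. When
`j` is injective, no information about the individual homogeneous components is lost. -/
lemma scaleHom_eq_scalePoly {T : Scheme.{0}} {K : Type} [CommRing K] {φ : PolyRing →+* K}
    {j : Polynomial K →+* Γ(T, ⊤)} {q : T ⟶ puncturedPlane} {a : (Γ(T, ⊤))ˣ}
    (ha : (a : Γ(T, ⊤)) = j Polynomial.X) (hq : planeHom q = (j.comp Polynomial.C).comp φ)
    (f : PolyRing) : planeHom (scalarAction.act a q) f = j (scalePoly φ f) := by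
  rw [planeHom_act, hq, ← RingHom.comp_apply j]
  congr 1
  apply MvPolynomial.ringHom_ext
  · simp [scaleHom, scalePoly]
  · intro i
    simp only [scaleHom, scalePoly, RingHom.comp_apply, MvPolynomial.eval₂Hom_X', ha, map_mul]

/-- Stable open subsets are cones. -/
lemma exists_eq_cone {U : puncturedPlane.Opens} (hU : scalarAction.Stable U) :
    ∃ V : projLine.Opens, U = cone V := by
  refine ⟨⟨conePoint ⁻¹' U, U.2.preimage continuous_conePoint⟩, Opens.ext (Set.ext fun p => ?_)⟩
  change p ∈ U ↔ conePoint (quotientPoint p) ∈ U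
  -- The homogeneous core is contained in the prime of `p`, so every open set containing `p`
  -- contains `conePoint (quotientPoint p)`. Only the reverse direction needs stability.
  have hp : conePoint (quotientPoint p) ⤳ p := by
    refine puncturedOpen.isOpenEmbedding.isInducing.specializes_iff.mp ?_
    exact (PrimeSpectrum.le_iff_specializes _ _).mp
      (Ideal.toIdeal_homogeneousCore_le polyGrading (planeIdeal p))
  refine ⟨fun h => hp.mem_open U.2 h, fun h => ?_⟩
  obtain ⟨T, K, _, φ, j, q, a, hj, ha, hq, hφ, hunit, ⟨t⟩, hqp⟩ := exists_generic_point p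
  -- The generic translate of `p` is the generic point of its line: `f` vanishes there if and only
  -- if `f(X x, X y)` is zero, that is, every component of `f` vanishes at `p`. Acting by the
  -- inverse unit then brings `p` back into `U`.
  have h1 : ∀ t, scalarAction.act a q t = conePoint (quotientPoint p) := fun t => by
    refine planeIdeal_injective (Ideal.ext fun f => ?_)
    rw [mem_planeIdeal_iff, scaleHom_eq_scalePoly ha hq]
    change _ ↔ f ∈ (planeIdeal p).homogeneousCore polyGrading
    rw [mem_homogeneousCore_iff_component, ← hφ]
    have h2 : (∀ k, polyComponent f k ∈ RingHom.ker φ) ↔ j (scalePoly φ f) = 0 := by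
      rw [map_eq_zero_iff j hj, Polynomial.ext_iff]
      exact forall_congr' fun k => by rw [coeff_scalePoly, RingHom.mem_ker, Polynomial.coeff_zero]
    rw [h2]
    constructor
    · intro h
      by_contra hf
      refine h ?_
      rw [Scheme.basicOpen_of_isUnit _ (hunit _ hf)]
      trivial
    · intro h
      rw [h, Scheme.basicOpen_zero]
      exact fun h => h
  have h2 := hU.act_mem a⁻¹ (q := scalarAction.act a q) (fun t => by rw [h1]; exact h) t
  rwa [← scalarAction.mul_act, inv_mul_cancel, scalarAction.one_act, hqp] at h2

/-! ### Basic open subsets of the projective line -/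

/-- Multiplying a homogeneous component by a coordinate nonzero at `v` gives two extra properties.
Divisibility by `X i` keeps `D(b)` away from the origin, and positive degree lets powers of `b`
reach arbitrarily large degrees. -/
lemma exists_basicOpen_le {V : projLine.Opens} {v : projLine} (hv : v ∈ V) :
    ∃ (j : ℕ) (b : PolyRing) (i : Fin 2), 1 ≤ j ∧ b ∈ polyGrading j ∧
      MvPolynomial.X i ∣ b ∧ v ∈ Proj.basicOpen polyGrading b ∧
      Proj.basicOpen polyGrading b ≤ V := by
  obtain ⟨_, ⟨f, rfl⟩, hvf, hfV⟩ := (ProjectiveSpectrum.isTopologicalBasis_basic_opens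
    polyGrading).exists_subset_of_mem_open (show v ∈ (V : Set projLine) from hv) V.2
  have hvf' : v ∈ ((⨆ k : ℕ, ProjectiveSpectrum.basicOpen polyGrading
      (GradedRing.proj polyGrading k f) :) : Opens (ProjectiveSpectrum polyGrading)) := by
    rw [← ProjectiveSpectrum.basicOpen_eq_union_of_projection]
    exact hvf
  obtain ⟨k, hk⟩ := Opens.mem_iSup.mp hvf'
  obtain ⟨i, hi⟩ := exists_X_notMem v
  refine ⟨k + 1, polyComponent f k * MvPolynomial.X i, i, by omega,
    SetLike.mul_mem_graded (polyComponent_mem f k) (MvPolynomial.isHomogeneous_X ℂ i),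
    dvd_mul_left _ _, ?_, ?_⟩
  · rw [Proj.basicOpen_mul]
    exact ⟨hk, hi⟩
  · rw [Proj.basicOpen_mul]
    refine inf_le_left.trans fun w hw => hfV ?_
    change w ∈ ProjectiveSpectrum.basicOpen polyGrading f
    rw [ProjectiveSpectrum.basicOpen_eq_union_of_projection]
    exact Opens.mem_iSup.mpr ⟨k, hw⟩

/-- Since `X i` divides `b`, the open subset `D(b)` of the whole plane misses the origin and equals
the cone over `D₊(b)`. -/
lemma cone_basicOpen_isAffineOpen {b : PolyRing} {j : ℕ} (hb : b ∈ polyGrading j) {i : Fin 2}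
    (hi : MvPolynomial.X i ∣ b) : IsAffineOpen (cone (Proj.basicOpen polyGrading b)) := by
  rw [← Scheme.Hom.isAffineOpen_iff_of_isOpenImmersion puncturedOpen.ι]
  have : puncturedOpen.ι ''ᵁ cone (Proj.basicOpen polyGrading b) =
      (PrimeSpectrum.basicOpen b : affinePlane.Opens) := by
    refine Opens.ext (Set.ext fun x => ⟨?_, fun hx => ?_⟩)
    · rintro ⟨p, hp, rfl⟩
      exact (mem_cone_basicOpen hb p).mp hp
    · have hxi : (MvPolynomial.X i : PolyRing) ∉ (x : PrimeSpectrum PolyRing).asIdeal :=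
        fun h => hx (Ideal.mem_of_dvd _ hi h)
      have hx' : x ∈ puncturedOpen := by
        fin_cases i
        · exact Or.inl hxi
        · exact Or.inr hxi
      exact ⟨⟨x, hx'⟩, (mem_cone_basicOpen hb ⟨x, hx'⟩).mpr hx, rfl⟩
  rw [this]
  exact IsAffineOpen.Spec_basicOpen (R := .of PolyRing) b

/-- Functions on the cone over a basic open subset are fractions. -/
lemma exists_pow_mul_eq_polyFun {b : PolyRing} {j : ℕ} (hb : b ∈ polyGrading j) {i : Fin 2}
    (hi : MvPolynomial.X i ∣ b)
    (h : Γ(puncturedPlane, cone (Proj.basicOpen polyGrading b))) :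
    ∃ (m : ℕ) (g : PolyRing), polyFun _ (b ^ m) * h = polyFun _ g := by
  -- The spectrum of this localization models the cone, with `q₀` below as its universal point;
  -- there every function is a fraction with a power of `b` as denominator.
  let R := Localization.Away b
  let T₀ : Scheme.{0} := Spec (.of R)
  let g₀ : T₀ ⟶ affinePlane := Spec.map (CommRingCat.ofHom (algebraMap PolyRing R))
  let e : R ≃+* Γ(T₀, ⊤) := (Scheme.ΓSpecIso (.of R)).symm.commRingCatIsoToRingEquiv
  have hg₀ : pointHom g₀ = (e : R →+* Γ(T₀, ⊤)).comp (algebraMap PolyRing R) :=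
    congrArg CommRingCat.Hom.hom
      (Scheme.ΓSpecIso_inv_naturality (CommRingCat.ofHom (algebraMap PolyRing R))).symm
  have hbu : IsUnit (pointHom g₀ b) := by
    rw [hg₀]
    exact (IsLocalization.Away.algebraMap_isUnit b).map (e : R →+* Γ(T₀, ⊤))
  have hbt : ∀ t, b ∉ (g₀ t : PrimeSpectrum PolyRing).asIdeal := fun t => by
    rw [mem_pointIdeal_iff, not_not, Scheme.basicOpen_of_isUnit _ hbu]
    trivial
  have hr : ∀ t, g₀ t ∈ puncturedOpen := fun t => by
    have hxi : (MvPolynomial.X i : PolyRing) ∉ (g₀ t : PrimeSpectrum PolyRing).asIdeal :=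
      fun h => hbt t (Ideal.mem_of_dvd _ hi h)
    fin_cases i
    · exact Or.inl hxi
    · exact Or.inr hxi
  let q₀ : T₀ ⟶ puncturedPlane := liftOpen g₀ puncturedOpen hr
  have hq₀ : planeHom q₀ = pointHom g₀ := by rw [planeHom, liftOpen_ι]
  have hq₀' : ∀ t, q₀ t ∈ cone (Proj.basicOpen polyGrading b) := fun t => by
    rw [mem_cone_basicOpen hb, mem_planeIdeal_iff, hq₀, not_not, Scheme.basicOpen_of_isUnit _ hbu]
    trivial
  obtain ⟨⟨g, ⟨_, m, rfl⟩⟩, hgm⟩ := IsLocalization.surj (Submonoid.powers b)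
    (e.symm (evalAt q₀ _ hq₀' h))
  refine ⟨m, g, ext_evalAt fun {T} q hq => ?_⟩
  -- At any point of the cone `b` is invertible, so the point factors through `q₀` and the identity
  -- is pulled back from there.
  obtain ⟨f, rfl⟩ : ∃ f, q = f ≫ q₀ := by
    let ψ : R →+* Γ(T, ⊤) := IsLocalization.Away.lift b (isUnit_planeHom hb le_rfl q hq)
    have hψ : ψ.comp (algebraMap PolyRing R) = planeHom q := IsLocalization.Away.lift_comp _ _
    refine ⟨T.toSpecΓ ≫ Spec.map (CommRingCat.ofHom ψ), ?_⟩
    rw [← cancel_mono puncturedOpen.ι, Category.assoc, liftOpen_ι]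
    refine pointHom_injective ?_
    have : (T.toSpecΓ ≫ Spec.map (CommRingCat.ofHom ψ)) ≫ g₀ = pointOf (planeHom q) := by
      rw [Category.assoc, ← Spec.map_comp, ← CommRingCat.ofHom_comp, hψ]
      rfl
    rw [this, pointHom_pointOf]
  rw [evalAt_comp f q₀ hq₀' hq, evalAt_comp f q₀ hq₀' hq, map_mul, evalAt_polyFun, evalAt_polyFun,
    hq₀, hg₀, RingHom.comp_apply, RingHom.comp_apply]
  congr 1
  have := congrArg e hgm
  rw [map_mul, e.apply_symm_apply] at this
  rw [mul_comm]
  exact this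

/-! ### Sections of the twisting sheaves are the homogeneous functions -/

/-- Locally `b f = a` with `b` invertible. Scaling multiplies `b` by `λ ^ j` and `a` by `λ ^ i`, so
cancellation leaves the factor `λ ^ (i - j) = λ ^ n` on `f`. -/
lemma IsTwistSection.isHomogeneous {n : ℤ} {V : projLine.Opens}
    {f : Γ(puncturedPlane, cone V)} (hf : IsTwistSection n V f) :
    scalarAction.IsHomogeneous n f := by
  intro T a q hq hq'
  choose W hW i j x b hv hx hb hij hWb e using hf
  let c : T ⟶ (cone V).toScheme := liftOpen q (cone V) hq
  -- The local fractions live over neighbourhoods indexed by points of `V`; their cones, indexed by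
  -- the points of `cone V`, form the covering used here.
  refine section_ext_over (I := (cone V).toScheme) c
    (U := fun p => (cone V).ι ⁻¹ᵁ cone (W (quotientPoint p.1) p.2))
    (fun p => ⟨p, hv _ p.2⟩) fun p Z z hz => ?_
  have hzq : (z ≫ c) ≫ (cone V).ι = z ≫ q := by rw [Category.assoc, liftOpen_ι]
  have hzW : ∀ t, (z ≫ q) t ∈ cone (W (quotientPoint p.1) p.2) := fun t => by
    rw [← hzq]
    exact hz t
  have hzW' : ∀ t, scalarAction.act (pullUnit z a) (z ≫ q) t ∈
      cone (W (quotientPoint p.1) p.2) := fun t => by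
    change quotientPoint _ ∈ W (quotientPoint p.1) p.2
    rw [quotientPoint_act]
    exact hzW t
  have key : ∀ (r : Z ⟶ puncturedPlane) (h : ∀ t, r t ∈ cone (W (quotientPoint p.1) p.2))
      (h' : ∀ t, r t ∈ cone V), planeHom r (b (quotientPoint p.1) p.2) * evalAt r (cone V) h' f =
        planeHom r (x (quotientPoint p.1) p.2) := fun r h h' => by
    have := congrArg (evalAt r _ h) (e (quotientPoint p.1) p.2)
    rw [map_mul, evalAt_polyFun, evalAt_polyFun] at this
    rw [← this]
    congr 1
    exact (evalAt_map r _ h h' f).symm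
  have h1 := key _ hzW (forall_comp_mem z hq)
  have hzV : ∀ t, scalarAction.act (pullUnit z a) (z ≫ q) t ∈ cone V := by
    rw [← scalarAction.comp_act]
    exact forall_comp_mem z hq'
  have h2 := key _ hzW' hzV
  rw [planeHom_act_of_mem _ _ (hb (quotientPoint p.1) p.2),
    planeHom_act_of_mem _ _ (hx (quotientPoint p.1) p.2), ← h1] at h2
  have hu := isUnit_planeHom (hb _ _) (hWb _ _) (z ≫ q) hzW
  have hpow : ((pullUnit z a : (Γ(Z, ⊤))ˣ) : Γ(Z, ⊤)) ^ i (quotientPoint p.1) p.2 =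
      (pullUnit z a ^ n).val * ((pullUnit z a : (Γ(Z, ⊤))ˣ) : Γ(Z, ⊤)) ^
        j (quotientPoint p.1) p.2 := by
    rw [← Units.val_pow_eq_pow_val, ← Units.val_pow_eq_pow_val, ← Units.val_mul, ← zpow_natCast,
      ← zpow_natCast, ← zpow_add]
    congr 2
    have := hij (quotientPoint p.1) p.2
    omega
  rw [map_mul, appTop_zpow, ← evalAt_comp z q hq (forall_comp_mem z hq),
    ← evalAt_comp z _ hq' (forall_comp_mem z hq'), evalAt_congr (scalarAction.comp_act z a q)]
  refine (hu.mul_right_inj).mp (((pullUnit z a).isUnit.pow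
    (j (quotientPoint p.1) p.2)).mul_right_inj.mp ?_)
  rw [hpow] at h2
  linear_combination h2

/-- On the cone over a basic open subset, `f` is a fraction with homogeneous denominator.
Homogeneity of `f` forces the numerator to scale by a single power of `λ`, and testing this with an
indeterminate over the generic point of the plane shows that it is a homogeneous polynomial. -/
lemma isTwistSection_of_isHomogeneous {n : ℤ} {V : projLine.Opens}
    {f : Γ(puncturedPlane, cone V)} (hf : scalarAction.IsHomogeneous n f) :
    IsTwistSection n V f := by
  intro v hv
  obtain ⟨j, b, i, hj, hb, hi, hvb, hbV⟩ := exists_basicOpen_le hv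
  obtain ⟨m, g, hg⟩ := exists_pow_mul_eq_polyFun hb hi (coneRes hbV f)
  -- The expected degree of the numerator may be negative if `n` is. Enlarging the fraction by `b ^
  -- n.natAbs` makes it a natural number, as `b` has degree at least one.
  obtain ⟨k, hk⟩ : ∃ k : ℕ, (k : ℤ) = (j * (m + n.natAbs) : ℕ) + n := by
    refine ⟨((j * (m + n.natAbs) : ℕ) + n).toNat, Int.toNat_of_nonneg ?_⟩
    have : m + n.natAbs ≤ j * (m + n.natAbs) := Nat.le_mul_of_pos_left _ hj
    omega
  have hg' : polyFun (cone (Proj.basicOpen polyGrading b)) (b ^ (m + n.natAbs)) *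
      coneRes hbV f = polyFun _ (g * b ^ n.natAbs) := by
    rw [map_mul, ← hg, pow_add, map_mul]
    ring
  refine ⟨_, hbV, k, j * (m + n.natAbs), g * b ^ n.natAbs, b ^ (m + n.natAbs), hvb, ?_, ?_,
    by omega, ?_, hg'⟩
  · generalize g * b ^ n.natAbs = g' at hg'
    -- At the generic point evaluation of polynomials is injective, so a comparison of values in `K`
    -- gives an equality of polynomials.
    obtain ⟨p, hp⟩ : ∃ p : puncturedPlane, planeIdeal p = ⊥ :=
      ⟨⟨(⟨⊥, Ideal.isPrime_bot⟩ : PrimeSpectrum PolyRing), Or.inl fun h =>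
        MvPolynomial.X_ne_zero (0 : Fin 2) (Ideal.mem_bot.mp h)⟩, rfl⟩
    obtain ⟨T, K, _, φ, J, q, a, hJ, ha, hq, hφ, -, -, hqp⟩ := exists_generic_point p
    have hinj : Function.Injective φ := (RingHom.injective_iff_ker_eq_bot φ).mpr (hφ.trans hp)
    have hqb : ∀ t, q t ∈ cone (Proj.basicOpen polyGrading b) := fun t => by
      rw [mem_cone_basicOpen hb, hqp, hp, Ideal.mem_bot]
      rintro rfl
      rw [Proj.basicOpen_zero] at hvb
      exact hvb
    have hqb' := GmAction.Stable.act_mem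
      (stable_cone (Proj.basicOpen polyGrading b)) a hqb
    have key : ∀ (r : T ⟶ puncturedPlane) (h : ∀ t, r t ∈ cone (Proj.basicOpen polyGrading b))
        (h' : ∀ t, r t ∈ cone V), planeHom r (b ^ (m + n.natAbs)) * evalAt r (cone V) h' f =
          planeHom r g' := fun r h h' => by
      have := congrArg (evalAt r _ h) hg'
      rw [map_mul, evalAt_polyFun, evalAt_polyFun] at this
      rw [← this]
      congr 1
      exact (evalAt_map r _ h h' f).symm
    have hqV : ∀ t, q t ∈ cone V := fun t => hbV (hqb t)
    have hqV' : ∀ t, scalarAction.act a q t ∈ cone V := fun t => hbV (hqb' t)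
    have h1 := key q hqb hqV
    have h2 := key _ hqb' hqV'
    rw [hf a q hqV hqV', map_pow, planeHom_act_of_mem a q hb] at h2
    have h3 : planeHom (scalarAction.act a q) g' = (a : Γ(T, ⊤)) ^ k * planeHom q g' := by
      have hpow : (a : Γ(T, ⊤)) ^ k = (a ^ n).val * (a : Γ(T, ⊤)) ^ (j * (m + n.natAbs)) := by
        rw [← Units.val_pow_eq_pow_val, ← Units.val_pow_eq_pow_val, ← Units.val_mul,
          ← zpow_natCast, ← zpow_natCast, ← zpow_add]
        congr 2
        omega
      rw [← h2, ← h1, hpow, map_pow, pow_mul]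
      ring
    rw [scaleHom_eq_scalePoly ha hq, hq, ha, ← map_pow, RingHom.comp_apply, RingHom.comp_apply,
      ← map_mul] at h3
    -- The coefficient of `X ^ k` identifies the value of the degree `k` component of `g'` with the
    -- value of `g'` itself.
    have h4 := congrArg (fun P => Polynomial.coeff P k) (hJ h3)
    simp only [coeff_scalePoly, Polynomial.coeff_X_pow_mul', le_refl, if_true, Nat.sub_self,
      Polynomial.coeff_C_zero] at h4
    rw [← hinj h4]
    exact polyComponent_mem g' k
  · rw [mul_comm]
    exact SetLike.pow_mem_graded (m + n.natAbs) hb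
  · intro w hw h
    exact hw ((w : ProjectiveSpectrum polyGrading).isPrime.mem_of_pow_mem _ h)

/-! ### The main theorem -/

namespace GaBundle

variable {S : Scheme.{0}}

/-- The identity of a bundle. -/
def Iso.refl (E : GaBundle S) : E.Iso E where
  iso := CategoryTheory.Iso.refl _
  comp_ρ := Category.id_comp _
  equivariant {T} a p := by simp

lemma evalAt_transition_add {E : GaBundle S} {U V W : S.Opens}
    (τ₁ : GaTrivialization E.ρ E.action U) (τ₂ : GaTrivialization E.ρ E.action V)
    (τ₃ : GaTrivialization E.ρ E.action W) {T : Scheme.{0}} (q : T ⟶ S) (hU : ∀ t, q t ∈ U)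
    (hV : ∀ t, q t ∈ V) (hW : ∀ t, q t ∈ W) :
    evalAt q _ (forall_mem_inf hU hV) (transition τ₁ τ₂) +
      evalAt q _ (forall_mem_inf hV hW) (transition τ₂ τ₃) =
      evalAt q _ (forall_mem_inf hU hW) (transition τ₁ τ₃) := by
  obtain ⟨p, hp⟩ : ∃ p, p ≫ E.ρ = q := ⟨τ₁.point q hU 0, by simp⟩
  subst hp
  rw [evalAt_transition τ₁ τ₂, evalAt_transition τ₂ τ₃, evalAt_transition τ₁ τ₃]
  ring

end GaBundle

/-- The class of a bundle with a lift as in `HasHomogeneousLift`. -/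
lemma HasHomogeneousLift.mem_range {n : ℤ} {E : GaBundle puncturedPlane}
    (h : HasHomogeneousLift n E) : E.cohomologyClass ∈ (twistH1Map n).range := by
  obtain ⟨σ', -, I, U, hU, τ, hcov, -, hτ⟩ := h
  choose V hV using fun i => exists_eq_cone (hU i)
  obtain rfl : U = fun i => cone (V i) := funext hV
  -- A cone contains `conePoint v` if and only if its base contains `v`, so the covering of the
  -- plane by cones descends to one of `ℙ¹`.
  have hex : ∀ v : projLine, ∃ i, v ∈ V i := fun v => by
    have : conePoint v ∈ ⨆ i, cone (V i) := by
      rw [hcov]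
      trivial
    obtain ⟨i, hi⟩ := Opens.mem_iSup.mp this
    refine ⟨i, ?_⟩
    have hi' : quotientPoint (conePoint v) ∈ V i := hi
    rwa [quotientPoint_conePoint] at hi'
  choose i hi using hex
  let 𝒱 : PointedCover projLine.carrier := ⟨fun v => V (i v), hi⟩
  let g : cechZ1 (twistingSheaf n) 𝒱 := ⟨fun v w => ⟨GaBundle.transition (τ (i v)) (τ (i w)),
    isTwistSection_of_isHomogeneous (V := 𝒱.nhd v ⊓ 𝒱.nhd w)
      (GaBundle.isHomogeneous_transition (hU _) (hU _) _ _ (hτ _) (hτ _))⟩, by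
    intro u v w
    refine Subtype.ext (ext_evalAt (S := puncturedPlane)
      (U := cone (𝒱.nhd u ⊓ 𝒱.nhd v ⊓ 𝒱.nhd w)) fun {T} q hq => ?_)
    have hu : ∀ t, q t ∈ cone (V (i u)) := fun t => (hq t).1.1
    have hv : ∀ t, q t ∈ cone (V (i v)) := fun t => (hq t).1.2
    have hw : ∀ t, q t ∈ cone (V (i w)) := fun t => (hq t).2
    refine (map_add (evalAt q _ hq) _ _).trans ?_
    exact (congrArg₂ (fun a b : Γ(T, ⊤) => a + b)
      (evalAt_map q _ hq (forall_mem_inf hu hv) _)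
      (evalAt_map q _ hq (forall_mem_inf hv hw) _)).trans
      ((GaBundle.evalAt_transition_add (τ (i u)) (τ (i v)) (τ (i w)) q hu hv hw).trans
        (evalAt_map q _ hq (forall_mem_inf hu hw) _).symm)⟩
  refine ⟨cechClass _ 𝒱 g, ?_⟩
  rw [GaBundle.cohomologyClass_eq (E := E) (𝒱.comap quotientMap)
    fun s => τ (i (quotientPoint s))]
  refine (cechH1Map_cechClass _ quotientMap (twistInclusion n) 𝒱 g).trans ?_
  refine congrArg (cechClass _ (𝒱.comap quotientMap)) (Subtype.ext ?_)
  funext x y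
  exact resHom_refl (addStructureSheaf puncturedPlane) _

/-- A bundle with class in `H¹(ℙ¹, 𝒪(n))` has a lift as in `HasHomogeneousLift`. -/
lemma hasHomogeneousLift_of_mem_range {n : ℤ} {E : GaBundle puncturedPlane}
    (h : E.cohomologyClass ∈ (twistH1Map n).range) : HasHomogeneousLift n E := by
  obtain ⟨c, hc⟩ := h
  obtain ⟨𝒱₀, g₀, rfl⟩ := exists_cechClass _ c
  -- Refining the covering of `ℙ¹` in this way makes the cones affine and does not change the class.
  choose j b i hj hb hi hvb hbV using fun v : projLine => exists_basicOpen_le (𝒱₀.mem_nhd v)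
  let 𝒱 : PointedCover projLine.carrier := ⟨fun v => Proj.basicOpen polyGrading (b v), hvb⟩
  have h𝒱 : 𝒱₀ ≤ 𝒱 := hbV
  let g := cechZ1Refine (twistingSheaf n) h𝒱 g₀
  have hg : cechClass _ 𝒱 g = cechClass _ 𝒱₀ g₀ := cechClass_refine _ h𝒱 g₀
  rw [← hg] at hc
  have hc' := (cechH1Map_cechClass _ quotientMap (twistInclusion n) 𝒱 g).symm.trans hc
  obtain ⟨W, h1, h2, s, hs⟩ := exists_of_cechClass_eq _ _ _ hc'.symm
  have hcone : ∀ p : puncturedPlane, ∃ v, p ∈ cone (𝒱.nhd v) := fun p =>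
    ⟨quotientPoint p, 𝒱.mem_nhd _⟩
  -- The covering `W` and the functions `s` carry no homogeneity. They serve only to find
  -- trivializations of `E` over the cones whose transition functions are exactly the cocycle `g` of
  -- `𝒪(n)`.
  obtain ⟨τ, hτ⟩ := GaBundle.exists_trivializations (E := E) (W := W.nhd)
    (fun s => ⟨s, W.mem_nhd s⟩)
    (fun x => GaBundle.restrictTrivialization (E.trivialization x) (h1 x))
    (U := fun v => cone (𝒱.nhd v)) (k := quotientPoint) (fun x => h2 x)
    (fun v w => (g.1 v w).1) s
    (fun u v w T q hu hv hw => by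
      have hq : ∀ t, q t ∈ cone (𝒱.nhd u ⊓ 𝒱.nhd v ⊓ 𝒱.nhd w) := fun t =>
        ⟨⟨hu t, hv t⟩, hw t⟩
      have h3 := congrArg (fun z => evalAt q _ hq (Subtype.val z)) (g.2 u v w)
      refine Eq.trans ?_ (h3.trans (evalAt_map q _ hq _ _))
      refine ((map_add (evalAt q _ hq) _ _).trans ?_).symm
      exact congrArg₂ (fun a b : Γ(T, ⊤) => a + b) (evalAt_map q _ hq _ _)
        (evalAt_map q _ hq _ _))
    (fun x y T q hx hy => by
      have hq := forall_mem_inf hx hy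
      have h3 := congrArg (fun z : Γ(puncturedPlane, W.nhd x ⊓ W.nhd y) =>
        evalAt q _ hq z) (hs x y)
      have h4 := (map_sub (evalAt q _ hq) _ _).symm.trans
        (h3.trans (map_sub (evalAt q _ hq) _ _))
      refine Eq.trans ?_ (h4.trans (congrArg₂ (fun a b : Γ(T, ⊤) => a - b)
        (evalAt_map q _ hq hy _) (evalAt_map q _ hq hx _)))
      refine congrArg₂ (fun a b : Γ(T, ⊤) => a - b) ?_ ?_
      · obtain ⟨p, hp⟩ : ∃ p, p ≫ E.ρ = q :=
          ⟨(E.trivialization x).point q (fun t => h1 x (hx t)) 0, by simp⟩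
        subst hp
        rw [GaBundle.evalAt_transition, GaBundle.fibreCoord_restrictTrivialization,
          GaBundle.fibreCoord_restrictTrivialization]
        exact ((evalAt_map (p ≫ E.ρ) _ hq _ _).trans
          (GaBundle.evalAt_transition (E.trivialization x) (E.trivialization y) p
            (forall_mem_inf (fun t => h1 x (hx t)) fun t => h1 y (hy t)))).symm
      · refine ((evalAt_map q _ hq (forall_mem_inf (U := cone (𝒱.nhd (quotientPoint x)))
          (V := cone (𝒱.nhd (quotientPoint y))) (fun t => h2 x (hx t))
          fun t => h2 y (hy t)) _).trans ?_).symm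
        refine congrArg (evalAt q _ _) ?_
        exact resHom_refl (addStructureSheaf puncturedPlane) _)
  obtain ⟨σ', hσ', hτ'⟩ := GaBundle.exists_lift (σ := scalarAction) (n := n) hcone
    (fun v => stable_cone (𝒱.nhd v)) τ fun v w => by
      rw [hτ]
      exact IsTwistSection.isHomogeneous (V := 𝒱.nhd v ⊓ 𝒱.nhd w) (g.1 v w).2
  refine ⟨σ', hσ', projLine, fun v => cone (𝒱.nhd v), fun v => stable_cone (𝒱.nhd v), τ,
    top_le_iff.mp fun p _ => ?_, fun v => cone_basicOpen_isAffineOpen (hb v) (hi v), hτ'⟩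
  obtain ⟨v, hv⟩ := hcone p
  exact Opens.mem_iSup.mpr ⟨v, hv⟩

end

theorem mainTheorem8 (d : ℤ) (E : GaBundle puncturedPlane) :
    E.cohomologyClass ∈ (twistH1Map (-d)).range ↔
      ∃ E' : GaBundle puncturedPlane, Nonempty (E.Iso E') ∧ HasHomogeneousLift (-d) E' := by
  constructor
  · intro h
    -- No change of bundle is needed: `exists_trivializations` produces the trivializations on `E`
    -- itself.
    exact ⟨E, ⟨GaBundle.Iso.refl E⟩, hasHomogeneousLift_of_mem_range h⟩
  · rintro ⟨E', ⟨f⟩, h⟩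
    rw [f.cohomologyClass_eq]
    exact h.mem_range
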